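/- For real $\alpha,\lambda,\theta$ with $\lambda\ge 0$ let $H_{\alpha,\lambda,\theta}$ be the almost Mathieu operator $$(H_{\alpha,\lambda,\theta}\psi)_n=\psi_{n+1}+\psi_{n-1}+2\lambda\cos\bigl(2\pi(n\alpha+\theta)\bigr)\,\psi_n ,$$ and let $\Sigma_{\alpha,\lambda,\theta}\subset\mathbb R$ be its spectrum as a bounded operator on $\ell^2(\mathbb Z)$. Define the intersection spectrum by $$\Sigma^-_{\alpha,\lambda}=\bigcap_{\theta}\Sigma_{\alpha,\lambda,\theta}\quad(0\le\lambda\le 1),\qquad \Sigma^-_{\alpha,\lambda}=\lambda\bigcap_{\theta}\Sigma_{\alpha,1/\lambda,\theta}\quad(\lambda>1),$$ and let $\mu^-_{\alpha,\lambda}$ be Lebesgue measure restricted to $\Sigma^-_{\alpha,\lambda}$. Let $\alpha=p/q$ with $p\in\mathbb Z$, $q\ge 1$ and $\gcd(p,q)=1$. Put $\theta_+=\frac{\alpha}{2}$ if $p$ is odd and $\theta_+=\frac{1+\alpha}{2}$ if $p$ is even. Let $\mathcal V_q^{\mathrm{per}}$ and $\mathcal V_q^{\mathrm{anti}}$ be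 the $q$-dimensional spaces of sequences $\psi:\mathbb Z\to\mathbb C$ with $\psi_{n+q}=\psi_n$, respectively $\psi_{n+q}=-\psi_n$, for all $n$. Both are preserved by the expression defining $H_{p/q,\lambda,\theta}$; let $H^{\mathrm{per}}_{q,\theta}$ and $H^{\mathrm{anti}}_{q,\theta}$ be its restrictions to them. Let $R_{\theta_+}:(\psi_n)\mapsto(\psi_{-1-n})$ on $\mathcal V_q^{\mathrm{per}}$ and $R_0:(\psi_n)\mapsto(\psi_{-n})$ on $\mathcal V_q^{\mathrm{anti}}$. For a diagonalizable operator $A$ with real eigenvalues on a finite-dimensional space, $\Phi(A)$ denotes the operator acting as multiplication by $\Phi(E)$ on the eigenspace of each eigenvalue $E$ of $A$. **Proposition.** Let $\lambda>1$, and let $\Phi,\varphi$ be complex-valued functions such that $\varphi$ is continuous on $\Sigma^-_{\alpha,\lambda}$ and $\Phi'(E)=\varphi(E)$ at every $E\in\Sigma^-_{\alpha,\lambda}$, the derivative being taken within $\Sigma^-_{\alpha,\lambda}$. Then $\varphi$ is $\mu^-_{\alpha,\lambda}$-integrable and $$\int\varphi(E)\,d\mu^-_{\alpha,\lambda}(E)=-\Bigl[\operatorname{tr}\bigl(\Phi(H^{\mathrm{per}}_{q,\theta_+})R_{\theta_+}\bigr)-\operatorname{tr}\bigl(\Phi(H^{\mathrm{anti}}_{q,0})R_0\bigr)\Bigr].$$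 -/

import Mathlib

noncomputable section

/-- The Hilbert space `ℓ²(ℤ)` of square-summable complex sequences. -/
abbrev EllTwo : Type := lp (fun _ : ℤ => ℂ) 2

/-- The potential `n ↦ 2 λ cos (2 π (n α + θ))` (real values, regarded in `ℂ`). -/
def amPotential (α lam θ : ℝ) (n : ℤ) : ℂ :=
  ((2 * lam * Real.cos (2 * Real.pi * (n * α + θ)) : ℝ) : ℂ)

/-- The almost Mathieu expression on arbitrary sequences:
`(H ψ) n = ψ (n + 1) + ψ (n - 1) + 2 λ cos (2 π (n α + θ)) ψ n`. -/
def amSeq (α lam θ : ℝ) : (ℤ → ℂ) →ₗ[ℂ] (ℤ → ℂ) where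
  toFun ψ n := ψ (n + 1) + ψ (n - 1) + amPotential α lam θ n * ψ n
  map_add' ψ χ := by
    funext n
    simp only [Pi.add_apply]
    ring
  map_smul' c ψ := by
    funext n
    simp only [Pi.smul_apply, smul_eq_mul, RingHom.id_apply]
    ring

theorem norm_amPotential_le (α lam θ : ℝ) (n : ℤ) : ‖amPotential α lam θ n‖ ≤ 2 * |lam| := by
  rw [amPotential, Complex.norm_real, Real.norm_eq_abs, abs_mul, abs_mul, abs_two]
  have h := Real.abs_cos_le_one (2 * Real.pi * (n * α + θ))
  have h2 : 0 ≤ 2 * |lam| := by positivity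
  nlinarith

/-- A translate of an `ℓ²` sequence is in `ℓ²`. -/
theorem memlp_translate (ψ : EllTwo) (k : ℤ) :
    Memℓp (E := fun _ : ℤ => ℂ) (fun n => (ψ : ℤ → ℂ) (n + k)) 2 := by
  have h := (memℓp_gen_iff (p := 2) (by simp)).1 (lp.memℓp ψ)
  exact (memℓp_gen_iff (p := 2) (by simp)).2 (h.comp_injective (add_left_injective k))

/-- The product of an `ℓ²` sequence with the potential is in `ℓ²`. -/
theorem memlp_potential_mul (α lam θ : ℝ) (ψ : EllTwo) :
    Memℓp (E := fun _ : ℤ => ℂ) (fun n => amPotential α lam θ n * (ψ : ℤ → ℂ) n) 2 := by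
  have h := (lp.memℓp ψ).const_smul (((2 * |lam| : ℝ) : ℂ))
  rw [memℓp_gen_iff (p := 2) (by simp)] at h ⊢
  refine Summable.of_nonneg_of_le (fun n => by positivity) (fun n => ?_) h
  refine Real.rpow_le_rpow (norm_nonneg _) ?_ (by simp)
  rw [Pi.smul_apply, smul_eq_mul, norm_mul, norm_mul, Complex.norm_real, Real.norm_eq_abs,
    abs_of_nonneg (by positivity : (0 : ℝ) ≤ 2 * |lam|)]
  exact mul_le_mul_of_nonneg_right (norm_amPotential_le α lam θ n) (norm_nonneg _)

/-- Translation `(ψ n) ↦ (ψ (n + k))` as a bounded operator on `ℓ²(ℤ)`. -/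
def translateCLM (k : ℤ) : EllTwo →L[ℂ] EllTwo :=
  LinearMap.mkContinuous
    { toFun := fun ψ => ⟨fun n => (ψ : ℤ → ℂ) (n + k), memlp_translate ψ k⟩
      map_add' := fun _ _ => rfl
      map_smul' := fun _ _ => rfl } 1 (by
    intro ψ
    rw [one_mul, lp.norm_eq_tsum_rpow (by simp), lp.norm_eq_tsum_rpow (by simp)]
    refine le_of_eq (congrArg (fun x : ℝ => x ^ (1 / (2 : ENNReal).toReal)) ?_)
    exact (Equiv.addRight k).tsum_eq (fun n => ‖(ψ : ℤ → ℂ) n‖ ^ (2 : ENNReal).toReal))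

/-- Multiplication by the potential as a bounded operator on `ℓ²(ℤ)`. -/
def potentialCLM (α lam θ : ℝ) : EllTwo →L[ℂ] EllTwo :=
  LinearMap.mkContinuous
    { toFun := fun ψ => ⟨fun n => amPotential α lam θ n * (ψ : ℤ → ℂ) n,
        memlp_potential_mul α lam θ ψ⟩
      map_add' := fun ψ χ => by
        ext n
        exact mul_add _ _ _
      map_smul' := fun c ψ => by
        ext n
        exact mul_left_comm _ _ _ } (2 * |lam|) (by
    intro ψ
    have h0 : (0 : ℝ) ≤ 2 * |lam| := by positivity
    have hn : ‖(((2 * |lam| : ℝ) : ℂ)) • ψ‖ = 2 * |lam| * ‖ψ‖ := by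
      rw [norm_smul, Complex.norm_real, Real.norm_eq_abs, abs_of_nonneg h0]
    rw [← hn]
    refine lp.norm_mono (by simp) (fun n => ?_)
    rw [lp.coeFn_smul, Pi.smul_apply, smul_eq_mul, norm_mul, Complex.norm_real,
      Real.norm_eq_abs, abs_of_nonneg h0]
    exact (norm_mul_le _ _).trans
      (mul_le_mul_of_nonneg_right (norm_amPotential_le α lam θ n) (norm_nonneg _)))

/-- The almost Mathieu operator `H_{α,λ,θ}` on `ℓ²(ℤ)`. -/
def almostMathieu (α lam θ : ℝ) : EllTwo →L[ℂ] EllTwo :=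
  translateCLM 1 + translateCLM (-1) + potentialCLM α lam θ

/-- The operator acts by the almost Mathieu expression. -/
theorem almostMathieu_apply (α lam θ : ℝ) (ψ : EllTwo) :
    ((almostMathieu α lam θ ψ : EllTwo) : ℤ → ℂ) = amSeq α lam θ (ψ : ℤ → ℂ) := rfl

/-- The spectrum `Σ_{α,λ,θ}`: the real `E` for which `H_{α,λ,θ} - E` is not invertible
among the bounded operators (as the operator is self-adjoint, its spectrum is real). -/
def amSpectrum (α lam θ : ℝ) : Set ℝ := spectrum ℝ (almostMathieu α lam θ)

/-- The intersection spectrum `Σ⁻_{α,λ}` (for `λ ≥ 0`): the intersection of the spectra over all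
phases when `λ ≤ 1`, extended to `λ > 1` by the convention `Σ⁻_{α,λ} = λ Σ⁻_{α,1/λ}`. -/
def intersectionSpectrum (α lam : ℝ) : Set ℝ :=
  if lam ≤ 1 then ⋂ θ : ℝ, amSpectrum α lam θ
  else (fun E : ℝ => lam * E) '' ⋂ θ : ℝ, amSpectrum α (1 / lam) θ

/-- The measure `μ⁻_{α,λ}`: Lebesgue measure restricted to `Σ⁻_{α,λ}`. -/
def intersectionMeasure (α lam : ℝ) : MeasureTheory.Measure ℝ :=
  MeasureTheory.volume.restrict (intersectionSpectrum α lam)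

/-- Sequences with `ψ (n + q) = ε ψ n` for all `n`, for a sign `ε = 1` or `ε = -1`. -/
def signedPeriodic (q : ℕ) (ε : ℤˣ) : Submodule ℂ (ℤ → ℂ) where
  carrier := {ψ | ∀ n : ℤ, ψ (n + q) = ((ε : ℤ) : ℂ) * ψ n}
  add_mem' := by
    intro ψ χ hψ hχ n
    simp only [Pi.add_apply, hψ n, hχ n]
    ring
  zero_mem' := by
    intro n
    simp
  smul_mem' := by
    intro c ψ hψ n
    simp only [Pi.smul_apply, smul_eq_mul, hψ n]
    ring

/-- The space `V_q^per` of `q`-periodic sequences, `ψ (n + q) = ψ n`. -/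
abbrev periodicSpace (q : ℕ) : Submodule ℂ (ℤ → ℂ) := signedPeriodic q 1

/-- The space `V_q^anti` of `q`-antiperiodic sequences, `ψ (n + q) = - ψ n`. -/
abbrev antiperiodicSpace (q : ℕ) : Submodule ℂ (ℤ → ℂ) := signedPeriodic q (-1)

theorem mem_signedPeriodic {q : ℕ} {ε : ℤˣ} {ψ : ℤ → ℂ} :
    ψ ∈ signedPeriodic q ε ↔ ∀ n : ℤ, ψ (n + q) = ((ε : ℤ) : ℂ) * ψ n := Iff.rfl

theorem unitSign_mul_self (ε : ℤˣ) : ((ε : ℤ) : ℂ) * ((ε : ℤ) : ℂ) = 1 := by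
  rcases Int.units_eq_one_or ε with h | h <;> simp [h]

theorem signedPeriodic_sub {q : ℕ} {ε : ℤˣ} {ψ : ℤ → ℂ} (h : ψ ∈ signedPeriodic q ε) (n : ℤ) :
    ψ (n - q) = ((ε : ℤ) : ℂ) * ψ n := by
  have h1 := h (n - q)
  rw [sub_add_cancel] at h1
  rw [h1, ← mul_assoc, unitSign_mul_self, one_mul]

/-- A (anti)periodic sequence is determined by its values on `0, …, q - 1`. -/
instance signedPeriodic_finite (q : ℕ) [NeZero q] (ε : ℤˣ) :
    FiniteDimensional ℂ (signedPeriodic q ε) := by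
  let f : signedPeriodic q ε →ₗ[ℂ] (Fin q → ℂ) :=
    { toFun := fun ψ i => (ψ : ℤ → ℂ) (i : ℕ)
      map_add' := fun _ _ => rfl
      map_smul' := fun _ _ => rfl }
  refine FiniteDimensional.of_injective f ?_
  rw [← LinearMap.ker_eq_bot, LinearMap.ker_eq_bot']
  intro ψ hψ
  have hq : (0 : ℤ) < q := by exact_mod_cast NeZero.pos q
  have hbase : ∀ r : ℤ, 0 ≤ r → r < q → (ψ : ℤ → ℂ) r = 0 := by
    intro r h0 h1
    have h2 := congrFun hψ ⟨r.toNat, by omega⟩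
    change (ψ : ℤ → ℂ) ((r.toNat : ℕ) : ℤ) = 0 at h2
    rwa [Int.toNat_of_nonneg h0] at h2
  have hstep : ∀ (k : ℕ) (r : ℤ), (ψ : ℤ → ℂ) r = 0 →
      (ψ : ℤ → ℂ) (r + k * q) = 0 ∧ (ψ : ℤ → ℂ) (r - k * q) = 0 := by
    intro k r hr
    induction k with
    | zero => simpa using hr
    | succ k ih =>
      constructor
      · have h := ψ.2 (r + k * q)
        rw [ih.1, mul_zero] at h
        have e : r + ((k + 1 : ℕ) : ℤ) * q = r + k * q + q := by
          push_cast
          ring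
        rw [e, h]
      · have h := signedPeriodic_sub ψ.2 (r - k * q)
        rw [ih.2, mul_zero] at h
        have e : r - ((k + 1 : ℕ) : ℤ) * q = r - k * q - q := by
          push_cast
          ring
        rw [e, h]
  ext n
  have hr := hbase (n % q) (Int.emod_nonneg _ hq.ne') (Int.emod_lt_of_pos _ hq)
  have hn := Int.emod_add_mul_ediv n q
  change (ψ : ℤ → ℂ) n = 0
  rcases Int.eq_nat_or_neg (n / q) with ⟨k, hk | hk⟩
  · have h := (hstep k _ hr).1
    rw [← h, ← hk, mul_comm (n / (q : ℤ)), hn]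
  · have h := (hstep k _ hr).2
    have e : n % (q : ℤ) - k * q = n := by
      rw [hk] at hn
      linarith
    rwa [e] at h

theorem amPotential_add (p : ℤ) (q : ℕ) (lam θ : ℝ) (n : ℤ) :
    amPotential ((p : ℝ) / q) lam θ (n + q) = amPotential ((p : ℝ) / q) lam θ n := by
  rcases Nat.eq_zero_or_pos q with hq | hq
  · simp [hq]
  · have hq' : (q : ℝ) ≠ 0 := by exact_mod_cast hq.ne'
    have h : 2 * Real.pi * (((n + q : ℤ) : ℝ) * ((p : ℝ) / q) + θ)
        = 2 * Real.pi * ((n : ℝ) * ((p : ℝ) / q) + θ) + p * (2 * Real.pi) := by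
      push_cast
      field_simp
      ring
    rw [amPotential, amPotential, h, Real.cos_add_int_mul_two_pi]

/-- For `α = p / q` the almost Mathieu expression preserves (anti)periodicity. -/
theorem amSeq_mem (p : ℤ) (q : ℕ) (ε : ℤˣ) (lam θ : ℝ) (ψ : ℤ → ℂ)
    (h : ψ ∈ signedPeriodic q ε) : amSeq ((p : ℝ) / q) lam θ ψ ∈ signedPeriodic q ε := by
  intro n
  change ψ (n + q + 1) + ψ (n + q - 1) + amPotential ((p : ℝ) / q) lam θ (n + q) * ψ (n + q)
    = ((ε : ℤ) : ℂ) * (ψ (n + 1) + ψ (n - 1) + amPotential ((p : ℝ) / q) lam θ n * ψ n)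
  rw [amPotential_add, h n, add_right_comm n (q : ℤ) 1, h (n + 1), add_sub_right_comm n (q : ℤ) 1,
    h (n - 1)]
  ring

/-- The restriction of `H_{p/q,λ,θ}` to the (anti)periodic sequences. -/
def amRestrict (p : ℤ) (q : ℕ) (ε : ℤˣ) (lam θ : ℝ) : Module.End ℂ (signedPeriodic q ε) :=
  (amSeq ((p : ℝ) / q) lam θ).restrict (amSeq_mem p q ε lam θ)

/-- `H^per_{q,θ}`, the restriction of `H_{p/q,λ,θ}` to `V_q^per`. -/
abbrev amPer (p : ℤ) (q : ℕ) (lam θ : ℝ) : Module.End ℂ (periodicSpace q) :=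
  amRestrict p q 1 lam θ

/-- `H^anti_{q,θ}`, the restriction of `H_{p/q,λ,θ}` to `V_q^anti`. -/
abbrev amAnti (p : ℤ) (q : ℕ) (lam θ : ℝ) : Module.End ℂ (antiperiodicSpace q) :=
  amRestrict p q (-1) lam θ

/-- The reflection `(ψ n) ↦ (ψ (c - n))` of the (anti)periodic sequences. -/
def signedReflection (q : ℕ) (ε : ℤˣ) (c : ℤ) : Module.End ℂ (signedPeriodic q ε) where
  toFun ψ := ⟨fun n => (ψ : ℤ → ℂ) (c - n), fun n => by
    change (ψ : ℤ → ℂ) (c - (n + q)) = _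
    rw [← sub_sub, signedPeriodic_sub ψ.2]⟩
  map_add' _ _ := rfl
  map_smul' _ _ := rfl

/-- `R_0 : (ψ n) ↦ (ψ (-n))` on the antiperiodic sequences. -/
abbrev reflZero (q : ℕ) : Module.End ℂ (antiperiodicSpace q) := signedReflection q (-1) 0

/-- `R_{θ₊} : (ψ n) ↦ (ψ (-1 - n))` on the periodic sequences. -/
abbrev reflPlus (q : ℕ) : Module.End ℂ (periodicSpace q) := signedReflection q 1 (-1)

/-- The phase `θ₊`: `α / 2` for odd `p`, and `(1 + α) / 2` for even `p`, where `α = p / q`. -/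
def thetaPlus (p : ℤ) (q : ℕ) : ℝ :=
  if Odd p then ((p : ℝ) / q) / 2 else (1 + (p : ℝ) / q) / 2

section FunctionalCalculus

variable {V : Type*} [AddCommGroup V] [Module ℂ V] [FiniteDimensional ℂ V]

theorem finite_realEigenvalues (A : Module.End ℂ V) :
    {E : ℝ | A.HasEigenvalue (E : ℂ)}.Finite := by
  have h := (Module.End.finite_spectrum A).preimage (f := ((↑) : ℝ → ℂ))
    Complex.ofReal_injective.injOn
  exact h.subset (fun E hE => Module.End.HasEigenvalue.mem_spectrum hE)

/-- The finite set of real eigenvalues of an operator. -/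
def realEigenvalues (A : Module.End ℂ V) : Finset ℝ := (finite_realEigenvalues A).toFinset

open Classical in
/-- `Φ(A)` for an operator `A` on a finite-dimensional space that is diagonalizable with real
eigenvalues (e.g. a self-adjoint operator): `P(A)`, where `P` is the interpolation polynomial with
`P(E) = Φ(E)` at every eigenvalue `E` of `A`. -/
def applyFun (Φ : ℝ → ℂ) (A : Module.End ℂ V) : Module.End ℂ V :=
  Polynomial.aeval A (Lagrange.interpolate (realEigenvalues A) (fun E : ℝ => (E : ℂ)) Φ)

/-- `Φ(A)` multiplies every eigenvector with real eigenvalue `E` by `Φ(E)`. -/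
theorem applyFun_apply (Φ : ℝ → ℂ) (A : Module.End ℂ V) (E : ℝ) (ψ : V)
    (h : A ψ = (E : ℂ) • ψ) : applyFun Φ A ψ = Φ E • ψ := by
  classical
  by_cases hψ : ψ = 0
  · simp [hψ]
  have hv : A.HasEigenvector (E : ℂ) ψ := ⟨Module.End.mem_eigenspace_iff.2 h, hψ⟩
  have hE : E ∈ realEigenvalues A := by
    simpa [realEigenvalues] using Module.End.hasEigenvalue_of_hasEigenvector hv
  rw [applyFun, Module.End.aeval_apply_of_hasEigenvector hv,
    Lagrange.eval_interpolate_at_node _ (Complex.ofReal_injective.injOn) hE]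

end FunctionalCalculus

end

/-!
For `α = p / q` the operator `H_{p/q,λ,θ}` is a `q`-periodic discrete Schrödinger operator, and a
real `E` is in its spectrum if and only if the discriminant at `E` (the trace of the transfer matrix
over one period) is in `[-2, 2]` (`mem_amSpectrum_iff`). By Chambers' formula the discriminant
depends on the phase only through an additive constant: it is `P(E) - 2 λ ^ q cos (2 π q θ)` for a
monic real polynomial `P` of degree `q`, the `levelPoly` (`disc_amReal`). Aubry duality relates the
polynomials for `λ` and `1 / λ` (`levelPoly_dual`), and intersecting over the phases one gets
`Σ⁻ = {E | |P(E)| ≤ K}` with `K = 2 λ ^ q - 2`, for `λ > 1` (`intersectionSpectrum_eq`).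

For `|t| ≤ 2 + 2 λ ^ q` the equation `P = t` is the eigenvalue equation of some `H_{p/q,λ,θ}` with a
unimodular Bloch multiplier, so all its roots are real; by Laguerre's inequality `P` has no critical
point where `|P| < 2 + 2 λ ^ q` (`derivative_levelPoly_ne_zero`). Therefore the roots of `P = K` and
`P = -K` are simple, and they are the endpoints of the bands that make up `Σ⁻`. By the fundamental
theorem of calculus the integral of `φ = Φ'` over `Σ⁻` is the sum of the values of `Φ` at the right
endpoints minus the sum of its values at the left endpoints (`integral_band`). A root of `P = K` is
a right endpoint exactly if `P' > 0` there; for `P = -K` it is the other way round.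

The roots of `P = K` are the eigenvalues of `H^anti` at phase `0`, those of `P = -K` the eigenvalues
of `H^per` at phase `θ₊`. They are simple, hence the reflection multiplies each eigenvector by a sign
`±1`, its parity, and both traces are sums of `Φ(E)` over the eigenvalues, weighted by the parities.
It remains to see that the parity at `E` is the sign of `P'(E)`
(`ReflectionProfile.parity_mul_derivative_pos`). The product of the two is a sum of values of a Green
function, the `reflectedTrace`, which is jointly continuous in `λ` and `E` and does not vanish at an
eigenvalue, since the eigenvalues stay simple for all couplings `λ > 0`. So its sign can be read off
at large coupling. There each eigenvalue is close to the potential at one reflection-symmetric pair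
of sites only; the Green function between the two is a sum of two continuants over the intervals that
separate them, each with the sign of the product of the `E - V n` over its interval. By the symmetry
this product is a square, up to the factor of a fixed site of the reflection, whose sign is known
(`ReflectionProfile.greenSol_pos`).
-/

noncomputable section
open Polynomial Filter Topology

/-! ### Second-order difference equations and their fundamental solution -/

section Fundamental

variable {R : Type*} [CommRing R]

/-- `u` solves the difference equation `u (n + 1) + u (n - 1) = d n * u n`; for
`d n = E - V n` this is the eigenvalue equation at energy `E` with potential `V`. -/
def IsSol (d u : ℤ → R) : Prop := ∀ n, u (n + 1) + u (n - 1) = d n * u n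

/-- The continuant: the value at `a + n` of the solution with values `0` at `a` and `1` at
`a + 1`. Equivalently, for `n ≥ 1`, the determinant of the tridiagonal matrix with diagonal
`d (a + 1), …, d (a + n - 1)` and off-diagonal entries `1`. -/
def continuant (d : ℤ → R) (a : ℤ) : ℕ → R
  | 0 => 0
  | 1 => 1
  | (n + 2) => d (a + (n + 1)) * continuant d a (n + 1) - continuant d a n

/-- The fundamental solution: as a function of `b` it solves the difference equation and takes
the values `0` at `a` and `1` at `a + 1`. -/
def fund (d : ℤ → R) (a b : ℤ) : R :=
  if a ≤ b then continuant d a (b - a).toNat else -continuant d b (a - b).toNat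

/-- Expansion of a continuant at its left end. -/
theorem continuant_left (d : ℤ → R) (a : ℤ) (n : ℕ) :
    continuant d (a - 1) (n + 2) = d a * continuant d a (n + 1) - continuant d (a + 1) n := by
  induction n using Nat.strong_induction_on with
  | _ n ih =>
    match n with
    | 0 => simp [continuant]
    | 1 =>
      simp only [continuant]
      norm_num [show a - 1 + 2 = a + 1 by ring, mul_comm]
    | (k + 2) =>
      rw [continuant, ih (k + 1) (by omega), ih k (by omega), continuant, continuant]
      push_cast
      rw [show a - 1 + ((k : ℤ) + 2 + 1) = a + (k + 1 + 1) by ring,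
        continuant.eq_3 d (a + 1)]
      rw [show a + 1 + ((k : ℤ) + 1) = a + (k + 1 + 1) by ring, continuant.eq_3 d a k]
      ring

theorem fund_add_nat (d : ℤ → R) (a : ℤ) (n : ℕ) : fund d a (a + n) = continuant d a n := by
  simp [fund]

theorem fund_swap (d : ℤ → R) (a b : ℤ) : fund d a b = -fund d b a := by
  unfold fund
  rcases lt_trichotomy a b with h | h | h
  · rw [if_pos h.le, if_neg h.not_ge, neg_neg]
  · subst h
    simp [continuant]
  · rw [if_pos h.le, if_neg h.not_ge]

@[simp] theorem fund_self (d : ℤ → R) (a : ℤ) : fund d a a = 0 := by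
  simp [fund, continuant]

@[simp] theorem fund_succ (d : ℤ → R) (a : ℤ) : fund d a (a + 1) = 1 := by
  simp [fund, continuant]

@[simp] theorem fund_succ_left (d : ℤ → R) (a : ℤ) : fund d (a + 1) a = -1 := by
  rw [fund_swap, fund_succ]

theorem isSol_fund (d : ℤ → R) (a : ℤ) : IsSol d (fund d a) := by
  intro b
  rcases lt_trichotomy a b with h | h | h
  · obtain ⟨k, rfl⟩ : ∃ k : ℕ, b = a + ((k + 1 : ℕ) : ℤ) := ⟨(b - a - 1).toNat, by omega⟩
    rw [show a + ((k + 1 : ℕ) : ℤ) + 1 = a + ((k + 2 : ℕ) : ℤ) by push_cast; ring,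
      show a + ((k + 1 : ℕ) : ℤ) - 1 = a + (k : ℤ) by push_cast; ring]
    simp only [fund_add_nat, continuant]
    push_cast
    ring
  · subst h
    rw [fund_self, fund_succ, fund_swap, show fund d (a - 1) a = 1 by
      simpa using fund_succ d (a - 1)]
    ring
  · obtain ⟨k, rfl⟩ : ∃ k : ℕ, a = b + ((k + 1 : ℕ) : ℤ) := ⟨(a - b - 1).toNat, by omega⟩
    rw [fund_swap d _ (b + 1), fund_swap d _ (b - 1), fund_swap d _ b]
    rw [fund_add_nat, show b + ((k + 1 : ℕ) : ℤ) = (b + 1) + (k : ℤ) by push_cast; ring,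
      fund_add_nat, show b + 1 + (k : ℤ) = (b - 1) + ((k + 2 : ℕ) : ℤ) by push_cast; ring,
      fund_add_nat, continuant_left]
    ring

theorem isSol_fund_left (d : ℤ → R) (b : ℤ) : IsSol d (fun a => fund d a b) := by
  intro a
  have h := isSol_fund d b a
  simp only [fund_swap d _ b]
  linear_combination -h

theorem IsSol.add {d u v : ℤ → R} (hu : IsSol d u) (hv : IsSol d v) :
    IsSol d (fun n => u n + v n) := by
  intro n
  linear_combination hu n + hv n

theorem IsSol.smul {d u : ℤ → R} (hu : IsSol d u) (c : R) : IsSol d (fun n => c * u n) := by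
  intro n
  linear_combination c * hu n

theorem IsSol.sub {d u v : ℤ → R} (hu : IsSol d u) (hv : IsSol d v) :
    IsSol d (fun n => u n - v n) := by
  intro n
  linear_combination hu n - hv n

theorem IsSol.shift {d u : ℤ → R} (hu : IsSol d u) {k : ℤ} (hd : ∀ n, d (n + k) = d n) :
    IsSol d (fun n => u (n + k)) := by
  intro n
  have h := hu (n + k)
  rw [hd] at h
  rw [← h, show n + k + 1 = n + 1 + k by ring, show n + k - 1 = n - 1 + k by ring]

theorem IsSol.reflect {d u : ℤ → R} (hu : IsSol d u) {c : ℤ} (hd : ∀ n, d (c - n) = d n) :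
    IsSol d (fun n => u (c - n)) := by
  intro n
  have h := hu (c - n)
  rw [hd] at h
  dsimp only
  rw [← h, show c - (n + 1) = c - n - 1 by ring, show c - (n - 1) = c - n + 1 by ring]
  ring

theorem IsSol.eq_zero {d u : ℤ → R} (hu : IsSol d u) {a : ℤ} (h0 : u a = 0)
    (h1 : u (a + 1) = 0) (n : ℤ) : u n = 0 := by
  have key : ∀ k : ℕ, (u (a + k) = 0 ∧ u (a + k + 1) = 0) ∧ (u (a - k) = 0 ∧ u (a - k + 1) = 0) := by
    intro k
    induction k with
    | zero => simp [h0, h1]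
    | succ k ih =>
      obtain ⟨⟨h2, h3⟩, h4, h5⟩ := ih
      push_cast
      refine ⟨⟨by rw [← add_assoc]; exact h3, ?_⟩, ?_, ?_⟩
      · have h := hu (a + k + 1)
        rw [h3, add_sub_cancel_right, h2] at h
        rw [← add_assoc]
        simpa using h
      · have h := hu (a - k)
        rw [h4, h5] at h
        rw [← sub_sub]
        simpa using h
      · rw [← sub_sub, sub_add_cancel]
        exact h4
  rcases le_total a n with h | h
  · have := (key (n - a).toNat).1.1
    rwa [Int.toNat_of_nonneg (by omega), add_sub_cancel] at this
  · have := (key (a - n).toNat).2.1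
    rwa [Int.toNat_of_nonneg (by omega), sub_sub_cancel] at this

theorem IsSol.ext {d u v : ℤ → R} (hu : IsSol d u) (hv : IsSol d v) {a : ℤ} (h0 : u a = v a)
    (h1 : u (a + 1) = v (a + 1)) (n : ℤ) : u n = v n :=
  sub_eq_zero.1 ((hu.sub hv).eq_zero (a := a) (by simp [h0]) (by simp [h1]) n)

theorem IsSol.eq_fund {d u : ℤ → R} (hu : IsSol d u) (a n : ℤ) :
    u n = u (a + 1) * fund d a n + u a * fund d n (a + 1) :=
  hu.ext (((isSol_fund d a).smul (u (a + 1))).add ((isSol_fund_left d (a + 1)).smul (u a)))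
    (a := a) (by simp) (by simp) n

theorem fund_add_period {d : ℤ → R} {k : ℤ} (hd : ∀ n, d (n + k) = d n) (a b : ℤ) :
    fund d (a + k) (b + k) = fund d a b :=
  ((isSol_fund d (a + k)).shift hd).ext (isSol_fund d a) (a := a) (by simp)
    (by simp [add_right_comm a 1 k]) b

/-- The discrete Wronskian of two sequences. -/
def wronsk (u v : ℤ → R) (k : ℤ) : R := u k * v (k + 1) - v k * u (k + 1)

/-- The discrete Lagrange (Green) identity. -/
theorem lagrange_identity (u v : ℤ → R) (a : ℤ) (N : ℕ) :
    ∑ i ∈ Finset.range N, (u (a + (i + 1)) * (v (a + (i + 1) + 1) + v (a + (i + 1) - 1))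
      - v (a + (i + 1)) * (u (a + (i + 1) + 1) + u (a + (i + 1) - 1)))
      = wronsk u v (a + N) - wronsk u v a := by
  induction N with
  | zero => simp
  | succ N ih =>
    rw [Finset.sum_range_succ, ih]
    simp only [wronsk]
    push_cast
    rw [show a + ((N : ℤ) + 1) - 1 = a + N by ring, show a + ((N : ℤ) + 1) = a + N + 1 by ring]
    ring

theorem wronsk_const {d u v : ℤ → R} (hu : IsSol d u) (hv : IsSol d v) (a b : ℤ) :
    wronsk u v a = wronsk u v b := by
  have hstep : ∀ k, wronsk u v (k + 1) = wronsk u v k := by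
    intro k
    have h := lagrange_identity u v k 1
    have hu1 := hu (k + 1)
    have hv1 := hv (k + 1)
    simp only [Finset.sum_range_one, Nat.cast_zero, Nat.cast_one, zero_add] at h
    rw [hu1, hv1] at h
    linear_combination -h
  have h : ∀ (k : ℕ) (a : ℤ), wronsk u v (a + k) = wronsk u v a := by
    intro k a
    induction k with
    | zero => simp
    | succ k ih => rw [← ih, ← hstep (a + k)]; push_cast; rw [add_assoc]
  rcases le_total a b with hab | hab
  · have := h (b - a).toNat a
    rw [Int.toNat_of_nonneg (by omega), add_sub_cancel] at this
    exact this.symm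
  · have := h (a - b).toNat b
    rwa [Int.toNat_of_nonneg (by omega), add_sub_cancel] at this

/-- The discriminant: the trace of the transfer matrix over the period `m + 1, …, m + q`. -/
def disc (d : ℤ → R) (q : ℕ) (m : ℤ) : R := fund d m (m + q + 1) - fund d (m + 1) (m + q)

theorem disc_eq_disc {d : ℤ → R} {q : ℕ} (hd : ∀ n, d (n + q) = d n) (m k : ℤ) :
    disc d q m = disc d q k := by
  have hstep : ∀ m, disc d q (m + 1) = disc d q m := by
    intro m
    have h1 := isSol_fund d (m + 1) (m + q + 1)
    have h2 := isSol_fund_left d (m + q + 1) (m + 1)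
    have h3 := hd (m + 1)
    simp only [add_sub_cancel_right] at h1 h2
    rw [show m + (q : ℤ) + 1 = m + 1 + q by ring, h3] at h1
    rw [show m + (q : ℤ) + 1 = m + 1 + q by ring] at h2
    simp only [disc]
    rw [show m + (q : ℤ) + 1 = m + 1 + q by ring]
    linear_combination h1 - h2
  have h : ∀ (k : ℕ) (a : ℤ), disc d q (a + k) = disc d q a := by
    intro k a
    induction k with
    | zero => simp
    | succ k ih => rw [← ih, ← hstep (a + k)]; push_cast; rw [add_assoc]
  rcases le_total m k with hab | hab
  · have := h (k - m).toNat m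
    rw [Int.toNat_of_nonneg (by omega), add_sub_cancel] at this
    exact this.symm
  · have := h (m - k).toNat k
    rwa [Int.toNat_of_nonneg (by omega), add_sub_cancel] at this

theorem disc_comp_add (d : ℤ → R) (q : ℕ) (m k : ℤ) :
    disc (fun n => d (n + k)) q m = disc d q (m + k) := by
  have h : ∀ a b, fund (fun n => d (n + k)) a b = fund d (a + k) (b + k) := by
    intro a b
    refine (isSol_fund _ a).ext (v := fun b => fund d (a + k) (b + k)) ?_ (a := a) (by simp)
      (by simp [add_right_comm a 1 k]) b
    intro n
    have h := isSol_fund d (a + k) (n + k)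
    rw [← h, show n + k + 1 = n + 1 + k by ring, show n + k - 1 = n - 1 + k by ring]
  simp only [disc, h]
  rw [show m + (q : ℤ) + 1 + k = m + k + q + 1 by ring, show m + 1 + k = m + k + 1 by ring,
    show m + (q : ℤ) + k = m + k + q by ring]

theorem map_continuant {S : Type*} [CommRing S] (f : R →+* S) (d : ℤ → R) (a : ℤ) (n : ℕ) :
    f (continuant d a n) = continuant (fun k => f (d k)) a n := by
  induction n using Nat.strong_induction_on with
  | _ n ih =>
    match n with
    | 0 => simp [continuant]
    | 1 => simp [continuant]
    | (k + 2) => simp [continuant, ih k (by omega), ih (k + 1) (by omega)]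

theorem map_fund {S : Type*} [CommRing S] (f : R →+* S) (d : ℤ → R) (a b : ℤ) :
    f (fund d a b) = fund (fun k => f (d k)) a b := by
  unfold fund
  split_ifs <;> simp [map_continuant]

theorem map_disc {S : Type*} [CommRing S] (f : R →+* S) (d : ℤ → R) (q : ℕ) (m : ℤ) :
    f (disc d q m) = disc (fun k => f (d k)) q m := by
  simp [disc, map_fund]

end Fundamental

/-! ### Bloch solutions -/

section Bloch

variable {F : Type*} [Field F] {d : ℤ → F} {q : ℕ}

/-- A Bloch solution with multiplier `ζ` forces the discriminant to be `ζ + ζ⁻¹`. -/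
theorem disc_eq_of_bloch {u : ℤ → F} {ζ : F} (hζ : ζ ≠ 0)
    (hu : IsSol d u) (hper : ∀ n, u (n + q) = ζ * u n) (hne : u ≠ 0) :
    disc d q 0 = ζ + ζ⁻¹ := by
  have hw := wronsk_const (isSol_fund d 0) (isSol_fund_left d 1) q 0
  have e0 := hu.eq_fund 0 q
  have e1 := hu.eq_fund 0 (q + 1)
  have p0 := hper 0
  have p1 := hper 1
  have hne' : u 0 ≠ 0 ∨ u 1 ≠ 0 := by
    by_contra! h
    exact hne (funext fun n => hu.eq_zero (a := 0) h.1 (by simpa using h.2) n)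
  simp only [wronsk, zero_add, fund_self] at *
  rw [show fund d 0 1 = 1 by simpa using fund_succ d 0] at hw
  rw [p0] at e0
  rw [add_comm (1 : ℤ) q] at p1
  rw [p1] at e1
  simp only [disc, zero_add]
  rw [fund_swap d 1 q]
  have key : ζ * ζ - (fund d 0 (q + 1) + fund d q 1) * ζ + 1 = 0 := by
    rcases hne' with h | h <;> apply mul_left_cancel₀ h
    · linear_combination (ζ - fund d 0 (q + 1)) * e0 + fund d 0 q * e1 + u 0 * hw
    · linear_combination (ζ - fund d q 1) * e1 + fund d (q + 1) 1 * e0 + u 1 * hw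
  field_simp
  linear_combination -key

/-- If the discriminant is `ζ + ζ⁻¹`, there is a Bloch solution with multiplier `ζ`. -/
theorem exists_bloch {ζ : F} (hd : ∀ n, d (n + q) = d n) (hζ : ζ ≠ 0)
    (h : disc d q 0 = ζ + ζ⁻¹) :
    ∃ u : ℤ → F, u ≠ 0 ∧ IsSol d u ∧ ∀ n, u (n + q) = ζ * u n := by
  have hw := wronsk_const (isSol_fund d 0) (isSol_fund_left d 1) q 0
  simp only [wronsk, zero_add, fund_self] at hw
  rw [show fund d 0 1 = 1 by simpa using fund_succ d 0] at hw
  simp only [disc, zero_add] at h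
  rw [fund_swap d 1 q] at h
  have h' : ζ * ζ - (fund d 0 (q + 1) + fund d q 1) * ζ + 1 = 0 := by
    rw [sub_neg_eq_add] at h
    rw [h]
    field_simp
    ring
  -- It suffices to find initial data `(x, y)` fixed up to the factor `ζ` by the transfer matrix.
  suffices hs : ∃ x y : F, (x ≠ 0 ∨ y ≠ 0) ∧ x * fund d 0 q + y * fund d q 1 = ζ * y ∧
      x * fund d 0 (q + 1) + y * fund d (q + 1) 1 = ζ * x by
    obtain ⟨x, y, hxy, e0, e1⟩ := hs
    have hsol : IsSol d (fun n => x * fund d 0 n + y * fund d n 1) :=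
      ((isSol_fund d 0).smul x).add ((isSol_fund_left d 1).smul y)
    have h01 : fund d 0 1 = 1 := by simpa using fund_succ d 0
    refine ⟨_, ?_, hsol, fun n => ?_⟩
    · intro h0
      have h2 := congrFun h0 0
      have h3 := congrFun h0 1
      simp only [fund_self, h01, Pi.zero_apply, mul_zero, mul_one, zero_add, add_zero] at h2 h3
      tauto
    · refine (hsol.shift hd).ext (hsol.smul ζ) (a := 0) ?_ ?_ n
      · simp only [zero_add, fund_self, h01]
        linear_combination e0
      · simp only [zero_add, fund_self, h01, add_comm (1 : ℤ) q]
        linear_combination e1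
  by_cases hc : fund d 0 q = 0
  · by_cases he : fund d q 1 = ζ
    · by_cases ha : fund d 0 (q + 1) = ζ
      · exact ⟨1, 0, by simp, by simp [hc], by simp [ha]⟩
      · refine ⟨-fund d (q + 1) 1, fund d 0 (q + 1) - ζ, Or.inr (sub_ne_zero.2 ha), ?_, ?_⟩
        · rw [hc, he]; ring
        · ring
    · refine ⟨1, 0, by simp, by simp [hc], ?_⟩
      have : (fund d 0 (q + 1) - ζ) * (fund d q 1 - ζ) = 0 := by
        rw [hc] at hw
        linear_combination h' - hw
      rcases mul_eq_zero.1 this with h2 | h2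
      · linear_combination h2
      · exact absurd (sub_eq_zero.1 h2) he
  · refine ⟨ζ - fund d q 1, fund d 0 q, Or.inr hc, by ring, ?_⟩
    linear_combination -h' + hw

end Bloch

/-! ### The derivative of the discriminant at a periodic or antiperiodic eigenvalue -/

section Green

/-- The discriminant of the potential `V` over the period `q`, as a polynomial in the energy. -/
def discPoly {R : Type*} [CommRing R] (V : ℤ → R) (q : ℕ) : R[X] := disc (fun n => X - C (V n)) q 0

theorem eval_discPoly {R : Type*} [CommRing R] (V : ℤ → R) (q : ℕ) (E : R) :
    (discPoly V q).eval E = disc (fun n => E - V n) q 0 := by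
  rw [discPoly, ← coe_evalRingHom, map_disc]
  simp

/-- The (anti)periodic Green function with source at `m`, multiplied by `disc - 2 ε`
(`ε = 1` or `ε = -1`). It solves the difference equation on all of `ℤ`, and it is
(anti)periodic exactly when the latter factor vanishes. -/
def greenSol {R : Type*} [CommRing R] (d : ℤ → R) (q : ℕ) (ε : R) (m k : ℤ) : R :=
  fund d k (m + q) + ε * fund d m k

theorem isSol_greenSol {R : Type*} [CommRing R] (d : ℤ → R) (q : ℕ) (ε : R) (m : ℤ) :
    IsSol d (greenSol d q ε m) :=
  (isSol_fund_left d (m + q)).add ((isSol_fund d m).smul ε)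

theorem lagrange_greenSol {R : Type*} [CommRing R] (V v : ℤ → R) {q : ℕ} {ε : R} (hε : ε * ε = 1)
    (E E₀ : R) (hv : IsSol (fun n => E₀ - V n) v) (hper : ∀ n, v (n + q) = ε * v n) (m : ℤ) :
    (E - E₀) * ∑ i ∈ Finset.range q,
      v (m + (i + 1)) * greenSol (fun n => E - V n) q ε m (m + (i + 1))
      = v m * (disc (fun n => E - V n) q m - 2 * ε) := by
  have hG := isSol_greenSol (fun n => E - V n) q ε m
  have h := lagrange_identity v (greenSol (fun n => E - V n) q ε m) m q
  have hs : ∀ k, v k * (greenSol (fun n => E - V n) q ε m (k + 1)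
      + greenSol (fun n => E - V n) q ε m (k - 1))
      - greenSol (fun n => E - V n) q ε m k * (v (k + 1) + v (k - 1))
      = (E - E₀) * (v k * greenSol (fun n => E - V n) q ε m k) := by
    intro k
    rw [hG k, hv k]
    ring
  simp only [hs] at h
  rw [Finset.mul_sum, h]
  have h1 := hper (m + 1)
  rw [add_right_comm] at h1
  simp only [wronsk, greenSol, hper, h1, disc, fund_self, fund_succ, fund_succ_left]
  linear_combination (-v (m + 1) * fund (fun n => E - V n) m (m + q)
    + v m * fund (fun n => E - V n) m (m + q + 1)) * hε

variable {V : ℤ → ℝ} {q : ℕ} {ε E : ℝ}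

/-- Summed against an eigenvector, the Green function gives the derivative of the
discriminant. -/
theorem sum_mul_greenSol (hV : ∀ n, V (n + q) = V n) (hε : ε * ε = 1) {v : ℤ → ℝ}
    (hv : IsSol (fun n => E - V n) v) (hper : ∀ n, v (n + q) = ε * v n) (m : ℤ) :
    ∑ i ∈ Finset.range q, v (m + (i + 1)) * greenSol (fun n => E - V n) q ε m (m + (i + 1))
      = v m * (derivative (discPoly V q)).eval E := by
  have h := lagrange_greenSol (fun n => C (V n)) (fun n => C (v n)) (q := q) (ε := C ε)
    (by rw [← C_mul, hε, C_1]) X (C E) (fun n => by simp only [← C_add, ← C_sub, ← C_mul, hv n])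
    (fun n => by rw [hper, C_mul]) m
  rw [disc_eq_disc (by simp [hV]) m 0] at h
  have h2 := congrArg (fun f => (derivative f).eval E) h
  simp only [derivative_mul, derivative_sub, derivative_X, derivative_C, eval_add, eval_mul,
    eval_sub, eval_X, eval_C, sub_self, zero_mul, add_zero, sub_zero, one_mul, zero_add,
    derivative_ofNat, mul_zero] at h2
  rw [discPoly, ← h2, eval_finsetSum]
  refine Finset.sum_congr rfl fun i _ => ?_
  rw [eval_mul, eval_C, greenSol, greenSol, eval_add, eval_mul, eval_C, ← coe_evalRingHom,
    map_fund, map_fund]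
  simp

theorem greenSol_add_period (hV : ∀ n, V (n + q) = V n) (hε : ε * ε = 1)
    (hE : disc (fun n => E - V n) q 0 = 2 * ε) (m k : ℤ) :
    greenSol (fun n => E - V n) q ε m (k + q) = ε * greenSol (fun n => E - V n) q ε m k := by
  have hd : ∀ n : ℤ, (fun n => E - V n) (n + q) = (fun n => E - V n) n := by simp [hV]
  have hG := isSol_greenSol (fun n => E - V n) q ε m
  refine (hG.shift hd).ext (hG.smul ε) (a := m) ?_ ?_ k
  · simp only [greenSol, fund_self]
    ring
  · rw [disc_eq_disc hd 0 m, disc] at hE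
    rw [add_right_comm]
    simp only [greenSol, fund_succ, fund_succ_left]
    linear_combination ε * hE + hε

/-- Where the derivative of the discriminant does not vanish, (anti)periodic solutions are unique
up to a factor. -/
theorem IsSol.proportional (hV : ∀ n, V (n + q) = V n) (hε : ε * ε = 1)
    (hE' : (derivative (discPoly V q)).eval E ≠ 0)
    {u v : ℤ → ℝ} (hu : IsSol (fun n => E - V n) u) (hv : IsSol (fun n => E - V n) v)
    (hup : ∀ n, u (n + q) = ε * u n) (hvp : ∀ n, v (n + q) = ε * v n) (hv0 : v ≠ 0) :
    ∃ g : ℝ, ∀ n, u n = g * v n := by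
  have hd : ∀ n : ℤ, (fun n => E - V n) (n + q) = (fun n => E - V n) n := by simp [hV]
  -- If the Wronskian did not vanish, every solution would be (anti)periodic, and then the Green
  -- functions would vanish identically.
  have hw : ∀ m, wronsk u v m = 0 := by
    intro m
    by_contra hne
    have hall : ∀ w, IsSol (fun n => E - V n) w → ∀ n, w (n + q) = ε * w n := by
      intro w hw n
      have hrep : ∀ k, w k = (wronsk w v m / wronsk u v m) * u k
          + (wronsk u w m / wronsk u v m) * v k := by
        refine hw.ext ((hu.smul _).add (hv.smul _)) (a := m) ?_ ?_ <;> field_simp <;>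
          simp only [wronsk] <;> ring
      rw [hrep, hrep n, hup, hvp]
      ring
    have hG : ∀ m k, greenSol (fun n => E - V n) q ε m k = 0 := by
      intro m k
      have h1 := hall _ (isSol_fund (fun n => E - V n) m) m
      have h2 := hall _ (isSol_fund (fun n => E - V n) (m + 1)) m
      refine (isSol_greenSol _ q ε m).eq_zero (a := m) ?_ ?_ k
      · simpa [greenSol] using h1
      · simp only [greenSol, fund_succ, h2, fund_succ_left]
        ring
    refine hv0 (funext fun m => ?_)
    have h := sum_mul_greenSol hV hε hv hvp m
    simp only [hG, mul_zero, Finset.sum_const_zero] at h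
    exact (mul_eq_zero.1 h.symm).resolve_right hE'
  obtain ⟨m, hm⟩ : ∃ m, v m ≠ 0 := by
    by_contra! h
    exact hv0 (funext h)
  refine ⟨u m / v m, hu.ext (hv.smul _) (a := m) (by field_simp) ?_⟩
  have h := hw m
  simp only [wronsk] at h
  field_simp
  linear_combination -h

/-- For a (anti)periodic eigenvector `v` of parity `π` under the reflection `n ↦ c - n`, the value
of the Green function at the reflected source has the sign of `π` times the derivative of the
discriminant. -/
theorem greenSol_reflect (hV : ∀ n, V (n + q) = V n) (hε : ε * ε = 1)
    (hE : disc (fun n => E - V n) q 0 = 2 * ε) (hE' : (derivative (discPoly V q)).eval E ≠ 0)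
    {v : ℤ → ℝ} (hv : IsSol (fun n => E - V n) v) (hvp : ∀ n, v (n + q) = ε * v n) (hv0 : v ≠ 0)
    {c : ℤ} {π : ℝ} (hπ : ∀ n, v (c - n) = π * v n) (m : ℤ) :
    greenSol (fun n => E - V n) q ε m (c - m) * ∑ i ∈ Finset.range q, v i ^ 2
      = π * (derivative (discPoly V q)).eval E * v m ^ 2 := by
  obtain ⟨g, hg⟩ := IsSol.proportional hV hε hE' (isSol_greenSol _ q ε m) hv
    (greenSol_add_period hV hε hE m) hvp hv0
  have h := sum_mul_greenSol hV hε hv hvp m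
  simp only [hg] at h
  have hsum : ∀ m : ℤ, ∑ i ∈ Finset.range q, v (m + (i + 1)) ^ 2
      = ∑ i ∈ Finset.range q, v i ^ 2 := by
    have hstep : ∀ m : ℤ, ∑ i ∈ Finset.range q, v (m + 1 + i) ^ 2
        = ∑ i ∈ Finset.range q, v (m + i) ^ 2 := by
      intro m
      have h1 := Finset.sum_range_succ (fun i : ℕ => v (m + i) ^ 2) q
      rw [Finset.sum_range_succ'] at h1
      have h2 : v (m + q) ^ 2 = v m ^ 2 := by
        rw [hvp]
        linear_combination v m ^ 2 * hε
      simp only [Nat.cast_zero, add_zero, h2] at h1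
      rw [← add_right_cancel h1]
      refine Finset.sum_congr rfl fun i _ => ?_
      push_cast
      rw [add_assoc, add_comm 1 (i : ℤ)]
    intro m
    have h0 : ∀ m : ℤ, ∑ i ∈ Finset.range q, v (m + i) ^ 2 = ∑ i ∈ Finset.range q, v i ^ 2 := by
      intro m
      induction m using Int.induction_on with
      | zero => simp
      | succ k ih => rw [hstep, ih]
      | pred k ih =>
        rw [← ih, ← hstep]
        simp
    rw [← h0 (m + 1)]
    exact Finset.sum_congr rfl fun i _ => by rw [add_assoc, add_comm 1 (i : ℤ)]
  rw [hg, hπ, ← hsum m]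
  calc g * (π * v m) * ∑ i ∈ Finset.range q, v (m + (i + 1)) ^ 2
      = π * v m * ∑ i ∈ Finset.range q, v (m + (i + 1)) * (g * v (m + (i + 1))) := by
        rw [Finset.mul_sum, Finset.mul_sum]
        exact Finset.sum_congr rfl fun i _ => by ring
    _ = _ := by rw [h]; ring

end Green

/-! ### Parities of eigenvectors at large coupling -/

section Coupling

/-- If the diagonal entries are at least `2` in absolute value, a continuant has the sign of their
product. -/
theorem continuant_sign {d : ℤ → ℝ} {a : ℤ} {n : ℕ} (h : ∀ i < n, 2 ≤ |d (a + 1 + (i : ℕ))|) :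
    0 < (∏ i ∈ Finset.range n, d (a + 1 + i)) * continuant d a (n + 1) ∧
      |continuant d a n| ≤ |continuant d a (n + 1)| := by
  induction n with
  | zero => simp [continuant]
  | succ n ih =>
    obtain ⟨h1, h2⟩ := ih fun i hi => h i (by omega)
    have hd := h n (by omega)
    rw [add_right_comm, add_assoc] at hd
    have hpos : 0 < |continuant d a (n + 1)| := by
      refine abs_pos.2 fun h0 => ?_
      rw [h0, mul_zero] at h1
      exact h1.false
    have hrec : continuant d a (n + 1 + 1)
        = d (a + (n + 1)) * continuant d a (n + 1) - continuant d a n := rfl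
    have hratio : |continuant d a n * (d (a + (n + 1)) * continuant d a (n + 1))|
        < (d (a + (n + 1)) * continuant d a (n + 1)) ^ 2 := by
      rw [← sq_abs (d (a + (n + 1)) * continuant d a (n + 1)), abs_mul, sq, abs_mul]
      have : 0 < |d (a + (n + 1))| * |continuant d a (n + 1)| := by positivity
      gcongr
      nlinarith
    have hs : 0 < d (a + (n + 1)) * continuant d a (n + 1) * continuant d a (n + 1 + 1) := by
      rw [hrec]
      nlinarith [abs_lt.1 hratio]
    constructor
    · rw [Finset.prod_range_succ]
      have e : a + 1 + (n : ℤ) = a + (n + 1) := by ring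
      rw [e]
      have hsq : 0 < continuant d a (n + 1) ^ 2 := by rw [← sq_abs]; positivity
      refine pos_of_mul_pos_left ?_ hsq.le
      calc 0 < ((∏ i ∈ Finset.range n, d (a + 1 + i)) * continuant d a (n + 1)) *
            (d (a + (n + 1)) * continuant d a (n + 1) * continuant d a (n + 1 + 1)) :=
            mul_pos h1 hs
        _ = _ := by ring
    · rw [hrec]
      have h3 := abs_sub_abs_le_abs_sub (d (a + (n + 1)) * continuant d a (n + 1))
        (continuant d a n)
      rw [abs_mul] at h3
      nlinarith

/-- Over a symmetric interval with an even number of sites the product is a square. -/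
theorem continuant_pos_of_symm {d : ℤ → ℝ} {a s : ℤ} {h : ℕ}
    (hbig : ∀ i < 2 * h, 2 ≤ |d (a + 1 + (i : ℕ))|)
    (hsymm : ∀ n, d (s - n) = d n) (hs : s = 2 * a + 2 * h + 1) :
    0 < continuant d a (2 * h + 1) := by
  have h1 := (continuant_sign hbig).1
  have h2 : ∏ i ∈ Finset.range (2 * h), d (a + 1 + i)
      = (∏ i ∈ Finset.range h, d (a + 1 + i)) ^ 2 := by
    rw [two_mul, Finset.prod_range_add, sq,
      ← Finset.prod_range_reflect (fun x : ℕ => d (a + 1 + ((h + x : ℕ) : ℤ)))]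
    congr 1
    refine Finset.prod_congr rfl fun i hi => ?_
    rw [Finset.mem_range] at hi
    rw [← hsymm]
    congr 1
    omega
  rw [h2] at h1
  exact pos_of_mul_pos_right h1 (sq_nonneg _)

/-- Over a symmetric interval with an odd number of sites the sign is that of the middle entry. -/
theorem mul_continuant_pos_of_symm {d : ℤ → ℝ} {a s : ℤ} {h : ℕ}
    (hbig : ∀ i < 2 * h + 1, 2 ≤ |d (a + 1 + (i : ℕ))|)
    (hsymm : ∀ n, d (s - n) = d n) (hs : s = 2 * a + 2 * h + 2) :
    0 < d (a + 1 + h) * continuant d a (2 * h + 2) := by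
  have h1 := (continuant_sign hbig).1
  have h2 : ∏ i ∈ Finset.range (2 * h + 1), d (a + 1 + i)
      = (∏ i ∈ Finset.range h, d (a + 1 + i)) ^ 2 * d (a + 1 + h) := by
    rw [show 2 * h + 1 = (h + 1) + h by ring, Finset.prod_range_add, Finset.prod_range_succ, sq,
      ← Finset.prod_range_reflect (fun x : ℕ => d (a + 1 + ((h + 1 + x : ℕ) : ℤ)))]
    rw [mul_right_comm]
    congr 2
    refine Finset.prod_congr rfl fun i hi => ?_
    rw [Finset.mem_range] at hi
    rw [← hsymm]
    congr 1
    omega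
  rw [h2, mul_assoc] at h1
  exact pos_of_mul_pos_right h1 (sq_nonneg _)

/-- A `q`-periodic profile `b` symmetric under `n ↦ c - n` which takes each value only on a
reflection-symmetric pair of residue classes, together with the sign `ε` of the boundary condition.
A fixed site `c / 2` of the reflection is a maximum, which occurs only with antiperiodic boundary
conditions, and a fixed site `(c + q) / 2` is a minimum. -/
structure ReflectionProfile (b : ℤ → ℝ) (q : ℕ) (c : ℤ) (ε : ℝ) : Prop where
  period : ∀ n, b (n + q) = b n
  symm : ∀ n, b (c - n) = b n
  inj : ∀ m n, b m = b n → (q : ℤ) ∣ m - n ∨ (q : ℤ) ∣ m + n - c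
  sign_even : Even c → ε = -1
  sign_odd : Odd c → ε = 1
  max : ∀ k, 2 * k = c → ∀ n, b n ≤ b k
  min : ∀ k, 2 * k = c + q → ∀ n, b k ≤ b n

variable {b : ℤ → ℝ} {q : ℕ} {c : ℤ} {ε : ℝ}

theorem ReflectionProfile.sign_mul_self (hb : ReflectionProfile b q c ε) : ε * ε = 1 := by
  rcases Int.even_or_odd c with h | h
  · rw [hb.sign_even h]; norm_num
  · rw [hb.sign_odd h]; norm_num

/-- At large coupling, the Green function from a site `m` where the potential is close to `E` to the
reflected site `c - m` is positive: it is a sum of two continuants over the reflection-symmetric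
intervals that separate these sites, and there the potential is far from `E`. -/
theorem ReflectionProfile.greenSol_pos (hb : ReflectionProfile b q c ε) (hq : 0 < q) {lam E : ℝ}
    (hlam : 0 < lam) (hgap : ∀ m n, b m ≠ b n → 4 ≤ lam * |b m - b n|) {m : ℤ} {j : ℕ}
    (hj : j ≤ q) (hm : c - m = m + j) (hE : |E - lam * b m| ≤ 2) :
    0 < greenSol (fun n => E - lam * b n) q ε m (c - m) := by
  set d : ℤ → ℝ := fun n => E - lam * b n with hd
  have hE' := abs_le.1 hE
  have hne : ∀ k : ℤ, (m < k ∧ k < m + j) ∨ (m + j < k ∧ k < m + q) → b k ≠ b m := by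
    intro k hk heq
    rcases hb.inj k m heq with ⟨t, ht⟩ | ⟨t, ht⟩
    · have h1 : 0 < (q : ℤ) * t := by omega
      have h2 : (q : ℤ) * t < q * 1 := by omega
      have h3 := pos_of_mul_pos_right h1 (by omega)
      have h4 := lt_of_mul_lt_mul_left h2 (by omega)
      omega
    · have h1 : (q : ℤ) * (-1) < (q : ℤ) * t := by omega
      have h2 : (q : ℤ) * t < q * 1 := by omega
      have h3 := lt_of_mul_lt_mul_left h1 (by omega)
      have h4 := lt_of_mul_lt_mul_left h2 (by omega)
      have h5 : t = 0 := by omega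
      subst h5
      omega
  have hbig : ∀ k : ℤ, (m < k ∧ k < m + j) ∨ (m + j < k ∧ k < m + q) → 2 ≤ |d k| := by
    intro k hk
    have h1 := hgap k m (hne k hk)
    have h2 : d k = (E - lam * b m) - lam * (b k - b m) := by simp only [hd]; ring
    have h3 := abs_sub_abs_le_abs_sub (lam * (b k - b m)) (E - lam * b m)
    rw [abs_mul, abs_of_pos hlam] at h3
    rw [h2, abs_sub_comm]
    linarith
  have hdmax : ∀ k : ℤ, (m < k ∧ k < m + j) ∨ (m + j < k ∧ k < m + q) →
      (∀ n, b n ≤ b k) → d k < 0 := by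
    intro k hk h
    have h1 := hgap k m (hne k hk)
    rw [abs_of_nonneg (by linarith [h m])] at h1
    simp only [hd]
    linarith
  have hdmin : ∀ k : ℤ, (m < k ∧ k < m + j) ∨ (m + j < k ∧ k < m + q) →
      (∀ n, b k ≤ b n) → 0 < d k := by
    intro k hk h
    have h1 := hgap k m (hne k hk)
    rw [abs_of_nonpos (by linarith [h m])] at h1
    simp only [hd]
    linarith
  have hs1 : ∀ n, d (c - n) = d n := fun n => by simp [hd, hb.symm]
  have hs2 : ∀ n, d (c + q - n) = d n := fun n => by
    rw [show c + q - n = c - n + q by ring]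
    simp [hd, hb.symm, hb.period]
  have h1 : 0 < j → 0 < ε * continuant d m j := by
    intro hj0
    rcases Nat.even_or_odd' j with ⟨h, rfl | rfl⟩
    · obtain ⟨h, rfl⟩ : ∃ h', h = h' + 1 := ⟨h - 1, by omega⟩
      have hc : c = 2 * (m + 1 + h) := by push_cast at hm; omega
      have h2 := mul_continuant_pos_of_symm (d := d) (a := m) (s := c) (h := h)
        (fun i hi => hbig _ (Or.inl (by omega))) hs1 (by rw [hc]; ring)
      have h3 := hdmax (m + 1 + h) (Or.inl (by omega)) (hb.max _ hc.symm)
      rw [hb.sign_even (by rw [hc]; exact even_two_mul _)]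
      have h4 := neg_of_mul_pos_right h2 h3.le
      rw [show 2 * (h + 1) = 2 * h + 2 by ring]
      linarith
    · have h2 := continuant_pos_of_symm (d := d) (a := m) (s := c) (h := h)
        (fun i hi => hbig _ (Or.inl (by omega))) hs1 (by push_cast at hm; omega)
      rw [hb.sign_odd ⟨m + h, by push_cast at hm; omega⟩, one_mul]
      exact h2
  have h2 : j < q → 0 < continuant d (m + j) (q - j) := by
    intro hjq
    rcases Nat.even_or_odd' (q - j) with ⟨h, hh | hh⟩
    · obtain ⟨h, rfl⟩ : ∃ h', h = h' + 1 := ⟨h - 1, by omega⟩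
      have hc : c + q = 2 * (m + j + 1 + h) := by omega
      have h2 := mul_continuant_pos_of_symm (d := d) (a := m + j) (s := c + q) (h := h)
        (fun i hi => hbig _ (Or.inr (by omega))) hs2 (by rw [hc]; ring)
      have h3 := hdmin (m + j + 1 + h) (Or.inr (by omega)) (hb.min _ hc.symm)
      rw [hh, show 2 * (h + 1) = 2 * h + 2 by ring]
      exact pos_of_mul_pos_right h2 h3.le
    · rw [hh]
      exact continuant_pos_of_symm (d := d) (a := m + j) (s := c + q) (h := h)
        (fun i hi => hbig _ (Or.inr (by omega))) hs2 (by omega)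
  rw [hm, greenSol, fund_add_nat, show m + (q : ℤ) = m + j + ((q - j : ℕ) : ℤ) by omega,
    fund_add_nat]
  rcases Nat.eq_zero_or_pos j with h0 | h0
  · have := h2 (by omega)
    subst h0
    simpa [continuant] using this
  · rcases hj.lt_or_eq with h3 | h3
    · exact add_pos (h2 h3) (h1 h0)
    · rw [h3, Nat.sub_self]
      have := h1 h0
      rw [h3] at this
      simpa [continuant] using this

/-- An (anti)periodic eigenvector has a site `m` where it does not vanish and the potential is
within `2` of the eigenvalue; by symmetry it can be chosen with `c - m` within one period to the
right of `m`. -/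
theorem ReflectionProfile.exists_site (hb : ReflectionProfile b q c ε) (hq : 0 < q) {lam E : ℝ}
    {v : ℤ → ℝ} (hv : IsSol (fun n => E - lam * b n) v) (hvp : ∀ n, v (n + q) = ε * v n)
    (hv0 : v ≠ 0) {π : ℝ} (hπ1 : |π| = 1) (hπ : ∀ n, v (c - n) = π * v n) :
    ∃ (m : ℤ) (j : ℕ), j ≤ q ∧ c - m = m + j ∧ v m ≠ 0 ∧ |E - lam * b m| ≤ 2 := by
  have hε : |ε| = 1 := by
    have h := hb.sign_mul_self
    rw [← abs_mul_abs_self] at h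
    nlinarith [abs_nonneg ε]
  have hper : Function.Periodic (fun n => |v n|) (q : ℤ) := fun n => by
    dsimp only
    rw [hvp, abs_mul, hε, one_mul]
  have hrefl : ∀ n, |v (c - n)| = |v n| := fun n => by rw [hπ, abs_mul, hπ1, one_mul]
  obtain ⟨i, -, hi⟩ := Finset.exists_max_image (Finset.range q) (fun i : ℕ => |v i|)
    ⟨0, Finset.mem_range.2 hq⟩
  have hmax : ∀ n, |v n| ≤ |v i| := by
    intro n
    have h1 : |v (n % q)| = |v n| := by
      have h := hper.sub_zsmul_eq (x := n) (n / q)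
      rw [← h, Int.emod_def, smul_eq_mul, mul_comm]
    rw [← h1]
    have h2 := hi (n % q).toNat (by
      have := Int.emod_lt_of_pos n (show (0 : ℤ) < q by omega)
      have := Int.emod_nonneg n (show (q : ℤ) ≠ 0 by omega)
      rw [Finset.mem_range]
      omega)
    rwa [Int.toNat_of_nonneg (Int.emod_nonneg n (by omega))] at h2
  suffices h : ∃ (m : ℤ) (j : ℕ), j ≤ q ∧ c - m = m + j ∧ |v m| = |v i| by
    obtain ⟨m, j, hj, hm, hvm⟩ := h
    have hvm0 : 0 < |v m| := by
      rcases (abs_nonneg (v m)).lt_or_eq with h | h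
      · exact h
      · refine absurd (funext fun n => ?_) hv0
        have := hmax n
        rw [← hvm, ← h] at this
        exact abs_nonpos_iff.1 this
    refine ⟨m, j, hj, hm, abs_pos.1 hvm0, ?_⟩
    have h1 := hv m
    have h2 := abs_add_le (v (m + 1)) (v (m - 1))
    rw [h1, abs_mul] at h2
    have h3 := hmax (m + 1)
    have h4 := hmax (m - 1)
    refine le_of_mul_le_mul_right ?_ hvm0
    linarith
  have hq2 : (0 : ℤ) < 2 * q := by omega
  have e := Int.emod_add_mul_ediv (c - 2 * i) (2 * q)
  have e1 := Int.emod_nonneg (c - 2 * i) hq2.ne'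
  have e2 := Int.emod_lt_of_pos (c - 2 * i) hq2
  set r := (c - 2 * i) % (2 * q)
  set t := (c - 2 * i) / (2 * (q : ℤ))
  have hm1 : |v (i + t * q)| = |v i| := by
    have h := hper.zsmul t (i : ℤ)
    simpa [smul_eq_mul] using h
  have e3 : c - 2 * i = r + 2 * (t * q) := by rw [← e]; ring
  rcases le_or_gt r q with h | h
  · exact ⟨i + t * q, r.toNat, by omega, by omega, hm1⟩
  · refine ⟨c - (i + t * q) - q, (2 * q - r).toNat, by omega, by omega, ?_⟩
    rw [← hm1, ← hrefl (i + t * q)]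
    have h := hper (c - (i + t * q) - q)
    simpa using h.symm

theorem ReflectionProfile.eventually_gap (hb : ReflectionProfile b q c ε) (hq : 0 < q) :
    ∀ᶠ lam : ℝ in Filter.atTop, ∀ m n, b m ≠ b n → 4 ≤ lam * |b m - b n| := by
  have hper : Function.Periodic b (q : ℤ) := hb.period
  have hmod : ∀ n : ℤ, ∃ i ∈ Finset.range q, b n = b (i : ℕ) := by
    intro n
    have e1 := Int.emod_nonneg n (show (q : ℤ) ≠ 0 by omega)
    have e2 := Int.emod_lt_of_pos n (show (0 : ℤ) < q by omega)
    refine ⟨(n % q).toNat, by rw [Finset.mem_range]; omega, ?_⟩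
    rw [Int.toNat_of_nonneg e1]
    have h := hper.sub_zsmul_eq (x := n) (n / q)
    rw [← h, Int.emod_def, smul_eq_mul, mul_comm]
  have h : ∀ᶠ lam : ℝ in Filter.atTop, ∀ i ∈ Finset.range q, ∀ j ∈ Finset.range q,
      b (i : ℕ) ≠ b (j : ℕ) → 4 ≤ lam * |b (i : ℕ) - b (j : ℕ)| := by
    rw [Filter.eventually_all_finset]
    intro i _
    rw [Filter.eventually_all_finset]
    intro j _
    by_cases hij : b (i : ℕ) = b (j : ℕ)
    · simp [hij]
    · have hpos : 0 < |b (i : ℕ) - b (j : ℕ)| := abs_pos.2 (sub_ne_zero.2 hij)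
      filter_upwards [(Filter.tendsto_id.atTop_mul_const hpos).eventually_ge_atTop 4]
        with lam h _ using h
  filter_upwards [h] with lam hl m n hmn
  obtain ⟨i, hi, ei⟩ := hmod m
  obtain ⟨j, hj, ej⟩ := hmod n
  rw [ei, ej] at hmn ⊢
  exact hl i hi j hj hmn

end Coupling

/-! ### Parities of eigenvectors at all couplings -/

section Homotopy

theorem continuous_fund {X : Type*} [TopologicalSpace X] {d : X → ℤ → ℝ}
    (hd : ∀ k, Continuous fun x => d x k) (a b : ℤ) : Continuous fun x => fund (d x) a b := by
  have h : ∀ (a : ℤ) (n : ℕ), Continuous fun x => continuant (d x) a n := by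
    intro a n
    induction n using Nat.strong_induction_on with
    | _ n ih =>
      match n with
      | 0 => exact continuous_const
      | 1 => exact continuous_const
      | (k + 2) => exact ((hd _).mul (ih _ (by omega))).sub (ih _ (by omega))
  unfold fund
  split_ifs
  · exact h _ _
  · exact (h _ _).neg

variable {b : ℤ → ℝ} {q : ℕ} {c : ℤ} {ε : ℝ}

/-- The sum of the values of the Green functions at the reflected sources. At an eigenvalue, this is
the trace of the product of the adjugate of `E - H` with the reflection. -/
def reflectedTrace (b : ℤ → ℝ) (q : ℕ) (c : ℤ) (ε lam E : ℝ) : ℝ :=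
  ∑ m ∈ Finset.range q, greenSol (fun n => E - lam * b n) q ε m (c - m)

theorem ReflectionProfile.exists_parity (hb : ReflectionProfile b q c ε) {lam E : ℝ}
    (hE : disc (fun n => E - lam * b n) q 0 = 2 * ε) :
    ∃ (v : ℤ → ℝ) (π : ℝ), IsSol (fun n => E - lam * b n) v ∧ (∀ n, v (n + q) = ε * v n) ∧
      v ≠ 0 ∧ |π| = 1 ∧ ∀ n, v (c - n) = π * v n := by
  have hε := hb.sign_mul_self
  have hε0 : ε ≠ 0 := by
    rintro rfl
    norm_num at hε
  obtain ⟨u, hu0, hu, hup⟩ := exists_bloch (d := fun n => E - lam * b n) (q := q) (ζ := ε)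
    (by simp [hb.period]) hε0 (by rw [hE, ← eq_inv_of_mul_eq_one_left hε]; ring)
  have hr := hu.reflect (c := c) (by simp [hb.symm])
  have hrp : ∀ n, u (c - (n + q)) = ε * u (c - n) := by
    intro n
    have h := hup (c - (n + q))
    rw [show c - (n + q) + q = c - n by ring] at h
    rw [h, ← mul_assoc, hε, one_mul]
  by_cases hs : (fun n => u n + u (c - n)) = 0
  · refine ⟨u, -1, hu, hup, hu0, by simp, fun n => ?_⟩
    have := congrFun hs n
    simp only [Pi.zero_apply] at this
    linarith
  · refine ⟨_, 1, hu.add hr, fun n => ?_, hs, by simp, fun n => ?_⟩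
    · rw [hup, hrp]
      ring
    · rw [sub_sub_cancel]
      ring

theorem sum_sq_pos {v : ℤ → ℝ} (hq : 0 < q) (hε : ε * ε = 1) (hvp : ∀ n, v (n + q) = ε * v n)
    (hv0 : v ≠ 0) : 0 < ∑ i ∈ Finset.range q, v i ^ 2 := by
  refine (Finset.sum_nonneg fun i _ => sq_nonneg _).lt_of_ne fun h => hv0 ?_
  rw [eq_comm, Finset.sum_eq_zero_iff_of_nonneg fun i _ => sq_nonneg _] at h
  have hper : Function.Periodic (fun n => v n ^ 2) (q : ℤ) := fun n => by
    dsimp only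
    rw [hvp]
    linear_combination v n ^ 2 * hε
  funext n
  have e1 := Int.emod_nonneg n (show (q : ℤ) ≠ 0 by omega)
  have e2 := Int.emod_lt_of_pos n (show (0 : ℤ) < q by omega)
  have h1 := h (n % q).toNat (by rw [Finset.mem_range]; omega)
  rw [Int.toNat_of_nonneg e1] at h1
  have h2 := hper.sub_zsmul_eq (x := n) (n / q)
  rw [smul_eq_mul, mul_comm, ← Int.emod_def] at h2
  rw [h2] at h1
  simpa using h1

/-- At an eigenvalue the reflected trace is the parity times the derivative of the discriminant. -/
theorem ReflectionProfile.reflectedTrace_eq (hb : ReflectionProfile b q c ε) (hq : 0 < q)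
    {lam E : ℝ} (hE : disc (fun n => E - lam * b n) q 0 = 2 * ε)
    (hE' : (derivative (discPoly (fun n => lam * b n) q)).eval E ≠ 0)
    {v : ℤ → ℝ} (hv : IsSol (fun n => E - lam * b n) v) (hvp : ∀ n, v (n + q) = ε * v n)
    (hv0 : v ≠ 0) {π : ℝ} (hπ : ∀ n, v (c - n) = π * v n) :
    reflectedTrace b q c ε lam E
      = π * (derivative (discPoly (fun n => lam * b n) q)).eval E := by
  have hS := sum_sq_pos hq hb.sign_mul_self hvp hv0
  refine mul_right_cancel₀ hS.ne' ?_
  rw [reflectedTrace, Finset.sum_mul, Finset.mul_sum]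
  exact Finset.sum_congr rfl fun m _ => greenSol_reflect (V := fun n => lam * b n)
    (by simp [hb.period]) hb.sign_mul_self hE hE' hv hvp hv0 hπ m

/-- The parity of a (anti)periodic eigenvector is the sign of the derivative of the discriminant.
The roots of `disc = 2 ε` being simple at every coupling, neither changes along a continuous
branch of eigenvalues, so it suffices to know the claim at large coupling. -/
theorem ReflectionProfile.parity_mul_derivative_pos (hb : ReflectionProfile b q c ε) (hq : 0 < q)
    (hb2 : ∀ n, |b n| ≤ 2)
    (hsimple : ∀ lam : ℝ, 0 < lam → ∀ E : ℝ, disc (fun n => E - lam * b n) q 0 = 2 * ε →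
      (derivative (discPoly (fun n => lam * b n) q)).eval E ≠ 0)
    {lam E : ℝ} (hlam : 0 < lam)
    {v : ℤ → ℝ} (hv : IsSol (fun n => E - lam * b n) v) (hvp : ∀ n, v (n + q) = ε * v n)
    (hv0 : v ≠ 0) {π : ℝ} (hπ : ∀ n, v (c - n) = π * v n) :
    0 < π * (derivative (discPoly (fun n => lam * b n) q)).eval E := by
  have hε := hb.sign_mul_self
  have hε0 : ε ≠ 0 := by
    rintro rfl
    norm_num at hε
  -- With the coupling written as `exp x`, the set `U` of the `x` for which the claim holds at all
  -- eigenvalues is shown to be open, closed and nonempty.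
  set g : ℝ → ℝ → ℝ := fun x E => reflectedTrace b q c ε (Real.exp x) E with hg
  set f : ℝ → ℝ → ℝ := fun x E => disc (fun n => E - Real.exp x * b n) q 0 - 2 * ε with hf
  have hdcont : ∀ k : ℤ, Continuous fun z : ℝ × ℝ => z.2 - Real.exp z.1 * b k := by
    intro k
    fun_prop
  have hfund : ∀ i j : ℤ, Continuous fun z : ℝ × ℝ => fund (fun n => z.2 - Real.exp z.1 * b n) i j :=
    continuous_fund hdcont
  have hgc : Continuous fun z : ℝ × ℝ => g z.1 z.2 :=
    continuous_finsetSum _ fun m _ => (hfund _ _).add (continuous_const.mul (hfund _ _))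
  have hfc : Continuous fun z : ℝ × ℝ => f z.1 z.2 :=
    ((hfund _ _).sub (hfund _ _)).sub continuous_const
  have hbound : ∀ x E, f x E = 0 → |E| ≤ 2 + 2 * Real.exp x := by
    intro x E h
    obtain ⟨v, π, hv, hvp, hv0, hπ1, hπ⟩ := hb.exists_parity (sub_eq_zero.1 h)
    obtain ⟨m, -, -, -, -, hm⟩ := hb.exists_site hq hv hvp hv0 hπ1 hπ
    have h1 := abs_sub_abs_le_abs_sub E (Real.exp x * b m)
    rw [abs_mul, abs_of_pos (Real.exp_pos x)] at h1
    nlinarith [hb2 m, Real.exp_pos x]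
  have hgne : ∀ x E, f x E = 0 → g x E ≠ 0 := by
    intro x E h
    have h' := sub_eq_zero.1 h
    obtain ⟨v, π, hv, hvp, hv0, hπ1, hπ⟩ := hb.exists_parity h'
    have hs := hsimple _ (Real.exp_pos x) E h'
    simp only [hg]
    rw [hb.reflectedTrace_eq hq h' hs hv hvp hv0 hπ]
    refine mul_ne_zero (fun h0 => ?_) hs
    rw [h0] at hπ1
    simp at hπ1
  set U : Set ℝ := {x | ∀ E, f x E = 0 → 0 < g x E} with hU
  have hopen : IsOpen U := by
    -- The eigenvalues for nearby couplings stay in one compact interval.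
    rw [isOpen_iff_mem_nhds]
    intro x₀ hx₀
    have hK : IsCompact (Set.Icc (-(2 + 2 * Real.exp (x₀ + 1))) (2 + 2 * Real.exp (x₀ + 1))) :=
      isCompact_Icc
    have h := hK.eventually_forall_of_forall_eventually (x₀ := x₀)
      (P := fun x E => f x E = 0 → 0 < g x E) (fun E _ => by
        by_cases hz : f x₀ E = 0
        · filter_upwards [hgc.continuousAt.eventually (lt_mem_nhds (hx₀ E hz))] with z hz _ using hz
        · filter_upwards [hfc.continuousAt.eventually_ne (y := (0 : ℝ)) (x := (x₀, E)) hz]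
            with z hz h0 using absurd h0 hz)
    filter_upwards [h, gt_mem_nhds (show x₀ < x₀ + 1 by linarith)] with x hx hlt E hE
    refine hx E (abs_le.1 ((hbound x E hE).trans ?_)) hE
    have := Real.exp_le_exp.2 hlt.le
    linarith
  have hclosed : IsClosed U := by
    -- By the sign change at a simple root, couplings near that of an eigenvalue with `g < 0` have an
    -- eigenvalue nearby, where `g < 0` too.
    rw [← isOpen_compl_iff, isOpen_iff_mem_nhds]
    intro x₁ hx₁
    obtain ⟨E₁, hE₁, hgle⟩ : ∃ E, f x₁ E = 0 ∧ g x₁ E ≤ 0 := by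
      simpa [hU] using hx₁
    have hglt : g x₁ E₁ < 0 := lt_of_le_of_ne hgle (hgne x₁ E₁ hE₁)
    set D := (derivative (discPoly (fun n => Real.exp x₁ * b n) q)).eval E₁ with hD
    have hD0 : D ≠ 0 := hsimple _ (Real.exp_pos x₁) E₁ (sub_eq_zero.1 hE₁)
    have hder : HasDerivAt (fun E => f x₁ E * D) (D * D) E₁ := by
      have h := (((discPoly (fun n => Real.exp x₁ * b n) q).hasDerivAt E₁).sub_const
        (2 * ε)).mul_const D
      simpa only [eval_discPoly] using h
    have hsign := eventually_nhdsWithin_sign_eq_of_deriv_pos (f := fun E => f x₁ E * D) (x₀ := E₁)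
      (by rw [hder.deriv]; exact mul_self_pos.2 hD0) (by simp [hE₁])
    obtain ⟨pa, hpa, pb, hpb, hab⟩ := eventually_prod_iff.1
      (nhds_prod_eq (x := x₁) (y := E₁) ▸ hgc.continuousAt.eventually (gt_mem_nhds hglt))
    obtain ⟨δ, hδ, hδ'⟩ := Metric.eventually_nhds_iff.1 (hsign.and hpb)
    have hlo := (hδ' (y := E₁ - δ / 2) (by rw [Real.dist_eq, abs_lt]; constructor <;> linarith)).1
    have hhi := (hδ' (y := E₁ + δ / 2) (by rw [Real.dist_eq, abs_lt]; constructor <;> linarith)).1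
    rw [show E₁ - δ / 2 - E₁ = -(δ / 2) by ring,
      sign_neg (show -(δ / 2) < 0 by linarith), sign_eq_neg_one_iff] at hlo
    rw [show E₁ + δ / 2 - E₁ = δ / 2 by ring, sign_pos (show 0 < δ / 2 by linarith),
      sign_eq_one_iff] at hhi
    have hcx : ∀ E, Continuous fun x => f x E * D := fun E =>
      (hfc.comp (Continuous.prodMk continuous_id continuous_const)).mul continuous_const
    filter_upwards [hpa, (hcx (E₁ - δ / 2)).continuousAt.eventually (gt_mem_nhds hlo),
      (hcx (E₁ + δ / 2)).continuousAt.eventually (lt_mem_nhds hhi)] with x h1 h2 h3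
    have hcE : Continuous fun E => f x E * D :=
      (hfc.comp (Continuous.prodMk continuous_const continuous_id)).mul continuous_const
    obtain ⟨E, hE, hE0⟩ := intermediate_value_Icc (show E₁ - δ / 2 ≤ E₁ + δ / 2 by linarith)
      hcE.continuousOn ⟨h2.le, h3.le⟩
    intro hxU
    have hz : f x E = 0 := (mul_eq_zero.1 hE0).resolve_right hD0
    have h4 := hab h1 (hδ' (y := E) (by
      rw [Real.dist_eq, abs_lt]
      constructor <;> linarith [hE.1, hE.2])).2
    exact absurd (hxU E hz) h4.not_gt
  have hne : U.Nonempty := by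
    obtain ⟨x, hx⟩ := (Real.tendsto_exp_atTop.eventually (hb.eventually_gap hq)).exists
    refine ⟨x, fun E hE => ?_⟩
    have h' := sub_eq_zero.1 hE
    obtain ⟨v, π, hv, hvp, hv0, hπ1, hπ⟩ := hb.exists_parity h'
    obtain ⟨m, j, hj, hm, hvm, hEm⟩ := hb.exists_site hq hv hvp hv0 hπ1 hπ
    have hs := hsimple _ (Real.exp_pos x) E h'
    have h1 := hb.greenSol_pos hq (Real.exp_pos x) hx hj hm hEm
    have h2 := greenSol_reflect (V := fun n => Real.exp x * b n) (by simp [hb.period]) hε h' hs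
      hv hvp hv0 hπ m
    simp only [hg]
    rw [hb.reflectedTrace_eq hq h' hs hv hvp hv0 hπ]
    have h3 := mul_pos h1 (sum_sq_pos hq hε hvp hv0)
    rw [h2] at h3
    exact pos_of_mul_pos_left h3 (sq_nonneg _)
  have hall : U = Set.univ := IsClopen.eq_univ ⟨hclosed, hopen⟩ hne
  have hx : Real.log lam ∈ U := hall ▸ Set.mem_univ _
  have hdisc : disc (fun n => E - lam * b n) q 0 = 2 * ε := by
    rw [disc_eq_of_bloch hε0 hv hvp hv0, ← eq_inv_of_mul_eq_one_left hε]
    ring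
  have h := hx E
  simp only [hf, hg, Real.exp_log hlam] at h
  rw [← hb.reflectedTrace_eq hq hdisc (hsimple lam hlam E hdisc) hv hvp hv0 hπ]
  exact h (sub_eq_zero.2 hdisc)

end Homotopy

/-! ### Chambers' formula and Aubry duality -/

section Chambers

/-- The almost Mathieu potential with complex phase variable `w`, at the frequency for which `ω`
is the rotation factor. On the unit circle, `w = e^{2 π i θ}`. -/
def cosPotential (ω lam w : ℂ) (n : ℤ) : ℂ := lam * (w * ω ^ n + w⁻¹ * ω ^ (-n))

/-- The continuants of `E - cosPotential ω lam w`, made polynomial in `w` by clearing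
denominators. -/
def clearedContinuant (ω lam E : ℂ) (a : ℤ) : ℕ → ℂ[X]
  | 0 => 0
  | 1 => 1
  | (k + 2) => (C E * X - C lam * (C (ω ^ (a + (k + 1))) * X ^ 2 + C (ω ^ (-(a + (k + 1))))))
      * clearedContinuant ω lam E a (k + 1) - X ^ 2 * clearedContinuant ω lam E a k

variable {ω : ℂ} {q : ℕ}

theorem eval_clearedContinuant (ω lam E : ℂ) (a : ℤ) {w : ℂ} (hw : w ≠ 0) (k : ℕ) :
    (clearedContinuant ω lam E a k).eval w * w
      = w ^ k * continuant (fun n => E - cosPotential ω lam w n) a k := by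
  induction k using Nat.strong_induction_on with
  | _ k ih =>
    match k with
    | 0 => simp [clearedContinuant, continuant]
    | 1 => simp [clearedContinuant, continuant]
    | (k + 2) =>
      have h1 := ih (k + 1) (by omega)
      have h2 := ih k (by omega)
      simp only [clearedContinuant, continuant, eval_sub, eval_mul, eval_C, eval_X, eval_add,
        eval_pow]
      rw [sub_mul, mul_assoc, h1, mul_assoc, h2]
      generalize continuant (fun n => E - cosPotential ω lam w n) a (k + 1) = K₁
      generalize continuant (fun n => E - cosPotential ω lam w n) a k = K₀
      simp only [cosPotential]
      field_simp
      ring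

theorem coeff_clearedContinuant_of_le (ω lam E : ℂ) (a : ℤ) (k n : ℕ) (h : 2 * k ≤ n + 1) :
    (clearedContinuant ω lam E a k).coeff n = 0 := by
  induction k using Nat.strong_induction_on generalizing n with
  | _ k ih =>
    match k with
    | 0 => simp [clearedContinuant]
    | 1 => simp [clearedContinuant, coeff_one]; omega
    | (k + 2) =>
      obtain ⟨n, rfl⟩ : ∃ n', n = n' + 2 := ⟨n - 2, by omega⟩
      simp only [clearedContinuant, sub_mul, mul_assoc, add_mul, coeff_sub, coeff_C_mul, coeff_add,
        mul_add, pow_two, coeff_X_mul]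
      rw [ih (k + 1) (by omega) n (by omega), ih k (by omega) n (by omega),
        ih (k + 1) (by omega) (n + 1) (by omega), ih (k + 1) (by omega) (n + 2) (by omega)]
      simp

theorem coeff_top_clearedContinuant (ω lam E : ℂ) (a : ℤ) (k : ℕ) :
    (clearedContinuant ω lam E a (k + 1)).coeff (2 * k)
      = ∏ i ∈ Finset.range k, (-lam * ω ^ (a + (i + 1))) := by
  induction k with
  | zero => simp [clearedContinuant]
  | succ k ih =>
    rw [Finset.prod_range_succ, ← ih]
    simp only [clearedContinuant, sub_mul, mul_assoc, add_mul, coeff_sub, coeff_C_mul, coeff_add,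
      mul_add, pow_two, coeff_X_mul, mul_one]
    rw [coeff_clearedContinuant_of_le ω lam E a (k + 1) (2 * k + 2) (by omega),
      coeff_clearedContinuant_of_le ω lam E a (k + 1) (2 * k + 1) (by omega),
      coeff_clearedContinuant_of_le ω lam E a k (2 * k) (by omega)]
    ring

theorem coeff_zero_clearedContinuant (ω lam E : ℂ) (a : ℤ) (k : ℕ) :
    (clearedContinuant ω lam E a (k + 1)).coeff 0
      = ∏ i ∈ Finset.range k, (-lam * ω ^ (-(a + (i + 1)))) := by
  induction k with
  | zero => simp [clearedContinuant]
  | succ k ih =>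
    rw [Finset.prod_range_succ, ← ih]
    simp only [clearedContinuant, coeff_zero_eq_eval_zero, eval_sub, eval_mul, eval_C, eval_X,
      eval_add, eval_pow]
    ring

theorem prod_neg_primitiveRoot (hω : IsPrimitiveRoot ω q) (hq : 0 < q) :
    ∏ i ∈ Finset.range q, (-ω ^ (i + 1)) = -1 := by
  have h1 : ∏ i ∈ Finset.range q, (-ω ^ (i + 1))
      = (-1) ^ q * (ω ^ q * ω ^ (∑ i ∈ Finset.range q, i)) := by
    rw [← Finset.prod_pow_eq_pow_sum]
    calc ∏ i ∈ Finset.range q, (-ω ^ (i + 1)) = ∏ i ∈ Finset.range q, ((-1 * ω) * ω ^ i) :=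
          Finset.prod_congr rfl fun i _ => by ring
      _ = _ := by
          rw [Finset.prod_mul_distrib, Finset.prod_const, Finset.card_range, mul_pow]
          ring
  rw [h1, hω.pow_eq_one, one_mul]
  have hs := Finset.sum_range_id_mul_two q
  rcases Nat.even_or_odd' q with ⟨h, rfl | rfl⟩
  · have hs' : ∑ i ∈ Finset.range (2 * h), i = h * (2 * (h - 1) + 1) := by
      obtain ⟨h, rfl⟩ : ∃ h', h = h' + 1 := ⟨h - 1, by omega⟩
      have e : 2 * (h + 1) - 1 = 2 * h + 1 := by omega
      rw [e] at hs
      simp only [Nat.add_sub_cancel]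
      linarith
    have hh : ω ^ h = -1 := by
      have h2 : (ω ^ h) ^ 2 = 1 := by rw [← pow_mul, mul_comm h 2, hω.pow_eq_one]
      rcases mul_self_eq_one_iff.1 ((sq _).symm.trans h2) with h3 | h3
      · exact absurd h3 (hω.pow_ne_one_of_pos_of_lt (by omega) (by omega))
      · exact h3
    rw [hs', pow_mul ω h, hh, pow_mul, pow_succ _ (2 * (h - 1)), pow_mul _ 2 (h - 1)]
    norm_num
  · have hs' : ∑ i ∈ Finset.range (2 * h + 1), i = (2 * h + 1) * h := by
      simp only [Nat.add_sub_cancel] at hs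
      linarith
    rw [hs', pow_mul, hω.pow_eq_one, one_pow, pow_succ, pow_mul]
    norm_num

theorem cosPotential_add_period (hω : IsPrimitiveRoot ω q) (hq : 0 < q) (lam w : ℂ) (n : ℤ) :
    cosPotential ω lam w (n + q) = cosPotential ω lam w n := by
  have hω0 : ω ≠ 0 := hω.ne_zero hq.ne'
  simp only [cosPotential, neg_add, zpow_add₀ hω0, zpow_neg, zpow_natCast, hω.pow_eq_one]
  simp

/-- **Chambers' formula**: the discriminant depends on the phase only through one term. It is a
Laurent polynomial in `w` of degree at most `q` which is invariant under `w ↦ ω w`, so that only the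
powers `w ^ q`, `1` and `w ^ (-q)` occur. -/
theorem chambers (hω : IsPrimitiveRoot ω q) (hq : 0 < q) (lam E : ℂ) :
    ∃ P : ℂ, ∀ w : ℂ, w ≠ 0 → disc (fun n => E - cosPotential ω lam w n) q 0
      = P - lam ^ q * (w ^ q + (w ^ q)⁻¹) := by
  have hω0 : ω ≠ 0 := hω.ne_zero hq.ne'
  obtain ⟨k, rfl⟩ : ∃ k, q = k + 1 := ⟨q - 1, by omega⟩
  set f : ℂ[X] := clearedContinuant ω lam E 0 (k + 1 + 1) - X ^ 2 * clearedContinuant ω lam E 1 k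
    with hf
  have hfw : ∀ w : ℂ, w ≠ 0 →
      f.eval w = w ^ (k + 1) * disc (fun n => E - cosPotential ω lam w n) (k + 1) 0 := by
    intro w hw
    have h1 := eval_clearedContinuant ω lam E 0 hw (k + 1 + 1)
    have h2 := eval_clearedContinuant ω lam E 1 hw k
    have e1 : fund (fun n => E - cosPotential ω lam w n) 0 (0 + ((k + 1 : ℕ) : ℤ) + 1)
        = continuant (fun n => E - cosPotential ω lam w n) 0 (k + 1 + 1) := by
      rw [← fund_add_nat]
      push_cast
      ring_nf
    have e2 : fund (fun n => E - cosPotential ω lam w n) (0 + 1) (0 + ((k + 1 : ℕ) : ℤ))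
        = continuant (fun n => E - cosPotential ω lam w n) 1 k := by
      rw [← fund_add_nat]
      push_cast
      ring_nf
    rw [disc, e1, e2, hf, eval_sub, eval_mul, eval_pow, eval_X]
    apply mul_right_cancel₀ hw
    linear_combination h1 - w ^ 2 * h2
  -- The shift of the potential by one site amounts to the rotation `w ↦ w ω`.
  have hinv : f.comp (C ω * X) = f := by
    refine Polynomial.funext fun w => ?_
    rw [eval_comp, eval_mul, eval_C, eval_X]
    rcases eq_or_ne w 0 with rfl | hw
    · simp
    · rw [hfw _ hw, hfw _ (mul_ne_zero hω0 hw), mul_pow, hω.pow_eq_one, one_mul]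
      congr 1
      have h1 : (fun n => E - cosPotential ω lam (ω * w) n)
          = fun n => (fun n => E - cosPotential ω lam w n) (n + 1) := by
        funext n
        simp only [cosPotential, neg_add, zpow_add₀ hω0, zpow_neg, zpow_one, mul_inv]
        ring
      rw [h1, disc_comp_add (fun n => E - cosPotential ω lam w n)]
      exact disc_eq_disc (fun n => by simp only [cosPotential_add_period hω hq]) _ _
  have hcoeff : ∀ n, f.coeff n ≠ 0 → n = 0 ∨ n = k + 1 ∨ n = 2 * (k + 1) := by
    intro n hn
    have h1 := congrArg (fun g => g.coeff n) hinv
    simp only [comp_C_mul_X_coeff] at h1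
    have h2 : ω ^ n = 1 := mul_left_cancel₀ hn (by rw [h1, mul_one])
    have h3 := (hω.pow_eq_one_iff_dvd n).1 h2
    have h4 : n < 2 * (k + 1) + 1 := by
      by_contra! h
      refine hn ?_
      obtain ⟨n, rfl⟩ : ∃ n', n = n' + 2 := ⟨n - 2, by omega⟩
      rw [hf, coeff_sub, coeff_clearedContinuant_of_le _ _ _ _ _ _ (by omega), coeff_X_pow_mul,
        coeff_clearedContinuant_of_le _ _ _ _ _ _ (by omega), sub_zero]
    obtain ⟨t, rfl⟩ := h3
    have : t < 3 := by nlinarith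
    interval_cases t <;> omega
  have htop : f.coeff (2 * (k + 1)) = -lam ^ (k + 1) := by
    rw [hf, coeff_sub, coeff_top_clearedContinuant, show 2 * (k + 1) = 2 * k + 2 by ring,
      coeff_X_pow_mul, coeff_clearedContinuant_of_le _ _ _ _ _ _ (by omega), sub_zero]
    have h := prod_neg_primitiveRoot hω hq
    calc ∏ i ∈ Finset.range (k + 1), (-lam * ω ^ ((0 : ℤ) + (i + 1)))
        = ∏ i ∈ Finset.range (k + 1), (lam * (-ω ^ (i + 1))) :=
          Finset.prod_congr rfl fun i _ => by
            rw [zero_add, show ((i : ℤ) + 1) = ((i + 1 : ℕ) : ℤ) by push_cast; ring, zpow_natCast]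
            ring
      _ = _ := by
          rw [Finset.prod_mul_distrib, h, Finset.prod_const, Finset.card_range]
          ring
  have hbot : f.coeff 0 = -lam ^ (k + 1) := by
    rw [hf, coeff_sub, coeff_zero_clearedContinuant, coeff_X_pow_mul']
    have h := prod_neg_primitiveRoot hω.inv hq
    simp only [show ¬ 2 ≤ 0 by omega, if_false, sub_zero]
    calc ∏ i ∈ Finset.range (k + 1), (-lam * ω ^ (-((0 : ℤ) + (i + 1))))
        = ∏ i ∈ Finset.range (k + 1), (lam * (-ω⁻¹ ^ (i + 1))) :=
          Finset.prod_congr rfl fun i _ => by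
            rw [zero_add, show ((i : ℤ) + 1) = ((i + 1 : ℕ) : ℤ) by push_cast; ring, zpow_neg,
              zpow_natCast, inv_pow]
            ring
      _ = _ := by
          rw [Finset.prod_mul_distrib, h, Finset.prod_const, Finset.card_range]
          ring
  have hform : f = C (f.coeff 0) + C (f.coeff (k + 1)) * X ^ (k + 1)
      + C (f.coeff (2 * (k + 1))) * X ^ (2 * (k + 1)) := by
    ext n
    simp only [coeff_add, coeff_C_mul, coeff_X_pow, coeff_C]
    by_cases h0 : n = 0
    · subst h0
      simp
    by_cases h1 : n = k + 1
    · subst h1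
      simp
    by_cases h2 : n = 2 * (k + 1)
    · subst h2
      simp
    · simp only [h0, h1, h2, if_false, mul_zero, add_zero]
      by_contra hn
      have := hcoeff n hn
      omega
  refine ⟨f.coeff (k + 1), fun w hw => ?_⟩
  have hw' : w ^ (k + 1) ≠ 0 := pow_ne_zero _ hw
  apply mul_left_cancel₀ hw'
  rw [← hfw w hw, hform]
  simp only [eval_add, eval_mul, eval_C, eval_pow, eval_X, coeff_add, coeff_C_mul, coeff_X_pow,
    coeff_C]
  rw [htop, hbot]
  field_simp
  simp
  ring

theorem sum_range_add_one_of_periodic {M : Type*} [AddCommGroup M] {f : ℤ → M}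
    (hf : ∀ n, f (n + q) = f n) :
    ∑ i ∈ Finset.range q, f (i + 1) = ∑ i ∈ Finset.range q, f i := by
  have h1 := Finset.sum_range_succ (fun i : ℕ => f i) q
  rw [Finset.sum_range_succ'] at h1
  have h2 := hf 0
  rw [zero_add] at h2
  simp only [Nat.cast_zero, h2] at h1
  rw [← add_right_cancel h1]
  exact Finset.sum_congr rfl fun i _ => by push_cast; rfl

/-- **Aubry duality**: the discrete Fourier transform exchanges the phase with the Bloch
multiplier and `lam` with `1 / lam`. -/
theorem aubry_duality (hω : IsPrimitiveRoot ω q) (hq : 0 < q) {lam w z E : ℂ} (hlam : lam ≠ 0)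
    (hw : w ≠ 0) (hz : z ≠ 0)
    (h : disc (fun n => E - cosPotential ω lam w n) q 0 = z ^ q + (z ^ q)⁻¹) :
    disc (fun n => lam⁻¹ * E - cosPotential ω lam⁻¹ z⁻¹ n) q 0 = w ^ q + (w ^ q)⁻¹ := by
  have hω0 : ω ≠ 0 := hω.ne_zero hq.ne'
  obtain ⟨u, hu0, hu, hup⟩ := exists_bloch
    (fun n => by simp only [cosPotential_add_period hω hq]) (pow_ne_zero q hz) h
  set χ : ℤ → ℂ := fun k => ∑ n ∈ Finset.range q, ω ^ ((n : ℤ) * k) * (z ^ (-(n : ℤ)) * u n) with hχ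
  have hper : ∀ k n : ℤ, ω ^ ((n + q) * k) * (z ^ (-(n + q)) * u (n + q))
      = ω ^ (n * k) * (z ^ (-n) * u n) := by
    intro k n
    rw [hup, add_mul, zpow_add₀ hω0, zpow_mul ω q k, zpow_natCast, hω.pow_eq_one, one_zpow,
      neg_add, zpow_add₀ hz, zpow_neg z q, zpow_natCast]
    field_simp
  -- The transforms of the translates of the Bloch function.
  have hplus : ∀ k : ℤ, ∑ n ∈ Finset.range q, ω ^ ((n : ℤ) * k) * (z ^ (-(n : ℤ)) * u (n + 1))
      = z * ω ^ (-k) * χ k := by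
    intro k
    have e := sum_range_add_one_of_periodic (f := fun n => ω ^ (n * k) * (z ^ (-n) * u n)) (hper k)
    simp only [hχ]
    rw [← e, Finset.mul_sum]
    refine Finset.sum_congr rfl fun n _ => ?_
    simp only [add_mul, zpow_add₀ hω0, neg_add, zpow_add₀ hz, one_mul, zpow_neg, zpow_one]
    field_simp
  have hminus : ∀ k : ℤ, ∑ n ∈ Finset.range q, ω ^ ((n : ℤ) * k) * (z ^ (-(n : ℤ)) * u (n - 1))
      = z⁻¹ * ω ^ k * χ k := by
    intro k
    have e := sum_range_add_one_of_periodic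
      (f := fun n => ω ^ (n * k) * (z ^ (-n) * u (n - 1))) (fun n => by
        have h1 := hper k (n - 1)
        rw [show n - 1 + (q : ℤ) = n + q - 1 by ring] at h1
        have e1 : ∀ m : ℤ, ω ^ (m * k) * (z ^ (-m) * u (m - 1))
            = ω ^ k * z⁻¹ * (ω ^ ((m - 1) * k) * (z ^ (-(m - 1)) * u (m - 1))) := by
          intro m
          rw [sub_mul, zpow_sub₀ hω0, neg_sub, zpow_sub₀ hz, one_mul, zpow_neg, zpow_one]
          field_simp
        rw [e1, h1, ← e1])
    rw [← e, hχ, Finset.mul_sum]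
    refine Finset.sum_congr rfl fun n _ => ?_
    simp only [add_mul, zpow_add₀ hω0, neg_add, zpow_add₀ hz, one_mul, zpow_neg, zpow_one,
      add_sub_cancel_right]
    field_simp
  have hχeq : ∀ k, z * ω ^ (-k) * χ k + z⁻¹ * ω ^ k * χ k
      + lam * (w * χ (k + 1) + w⁻¹ * χ (k - 1)) = E * χ k := by
    intro k
    have h1 : ∀ n ∈ Finset.range q, ω ^ ((n : ℤ) * k) * (z ^ (-(n : ℤ)) * u (n + 1))
        + ω ^ ((n : ℤ) * k) * (z ^ (-(n : ℤ)) * u (n - 1))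
        + lam * (w * (ω ^ ((n : ℤ) * (k + 1)) * (z ^ (-(n : ℤ)) * u n))
          + w⁻¹ * (ω ^ ((n : ℤ) * (k - 1)) * (z ^ (-(n : ℤ)) * u n)))
        = E * (ω ^ ((n : ℤ) * k) * (z ^ (-(n : ℤ)) * u n)) := by
      intro n _
      have h2 := hu n
      simp only [cosPotential] at h2
      simp only [mul_add, mul_sub, zpow_add₀ hω0, zpow_sub₀ hω0, mul_one]
      rw [zpow_neg ω n] at h2
      linear_combination (ω ^ ((n : ℤ) * k) * z ^ (-(n : ℤ))) * h2
    have h2 := Finset.sum_congr rfl h1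
    rw [Finset.sum_add_distrib, Finset.sum_add_distrib, hplus, hminus, ← Finset.mul_sum,
      Finset.sum_add_distrib, ← Finset.mul_sum, ← Finset.mul_sum, ← Finset.mul_sum] at h2
    exact h2
  have hχ0 : χ ≠ 0 := by
    intro h0
    have hinj : Function.Injective fun j : Fin q => ω ^ (j : ℕ) := fun i j hij =>
      Fin.ext (hω.pow_inj i.2 j.2 hij)
    have hv := Matrix.eq_zero_of_forall_pow_sum_mul_pow_eq_zero
      (v := fun j : Fin q => z ^ (-((j : ℕ) : ℤ)) * u (j : ℕ)) hinj (fun i => by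
        have h1 := congrFun h0 ((i : ℕ) : ℤ)
        simp only [hχ, Pi.zero_apply] at h1
        rw [Finset.sum_range] at h1
        rw [← h1]
        refine Finset.sum_congr rfl fun j _ => ?_
        rw [mul_comm, ← pow_mul, ← zpow_natCast]
        push_cast
        rfl)
    have hz0 : ∀ n : ℕ, n < q → u n = 0 := by
      intro n hn
      have h1 := congrFun hv ⟨n, hn⟩
      simpa [hz] using h1
    have hall : u 0 = 0 ∧ u (0 + 1) = 0 := by
      refine ⟨by simpa using hz0 0 hq, ?_⟩
      rcases Nat.lt_or_ge 1 q with h1 | h1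
      · simpa using hz0 1 h1
      · have hq1 : q = 1 := by omega
        subst hq1
        have h2 := hup 0
        have h3 := hz0 0 hq
        rw [Nat.cast_zero] at h3
        simpa [h3] using h2
    exact hu0 (funext fun n => hu.eq_zero hall.1 hall.2 n)
  refine disc_eq_of_bloch (u := fun k => w ^ k * χ k) (pow_ne_zero q hw) ?_ ?_ ?_
  · intro k
    have h1 := hχeq k
    simp only [cosPotential, zpow_add₀ hw, zpow_sub₀ hw, zpow_one, inv_inv]
    field_simp at h1 ⊢
    linear_combination h1
  · intro k
    have h1 : χ (k + q) = χ k := by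
      simp only [hχ, mul_add, zpow_add₀ hω0]
      refine Finset.sum_congr rfl fun n _ => ?_
      rw [mul_comm (n : ℤ) q, zpow_mul ω q, zpow_natCast ω q, hω.pow_eq_one, one_zpow, mul_one]
    rw [h1, zpow_add₀ hw, zpow_natCast]
    ring
  · intro h0
    refine hχ0 (funext fun k => ?_)
    have h1 := congrFun h0 k
    simpa [zpow_ne_zero k hw] using h1

end Chambers

/-! ### Real-rootedness and simplicity of the levels of the discriminant -/

section RealRooted

theorem continuant_monic {R : Type*} [CommRing R] [Nontrivial R] (V : ℤ → R) (a : ℤ) (k : ℕ) :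
    (continuant (fun n => X - C (V n)) a (k + 1)).Monic ∧
      (continuant (fun n => X - C (V n)) a (k + 1)).natDegree = k ∧
      (continuant (fun n => X - C (V n)) a k).degree < (k : WithBot ℕ) := by
  induction k with
  | zero => simp [continuant]
  | succ k ih =>
    obtain ⟨h1, h2, h3⟩ := ih
    have hm := (monic_X_sub_C (V (a + (k + 1)))).mul h1
    have hd : ((X - C (V (a + (k + 1)))) * continuant (fun n => X - C (V n)) a (k + 1)).natDegree
        = k + 1 := by
      rw [(monic_X_sub_C (V (a + (k + 1)))).natDegree_mul h1, natDegree_X_sub_C, h2, add_comm]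
    have hlt : (continuant (fun n => X - C (V n)) a k).degree
        < ((X - C (V (a + (k + 1)))) * continuant (fun n => X - C (V n)) a (k + 1)).degree := by
      rw [degree_eq_natDegree hm.ne_zero, hd]
      exact h3.trans (by exact_mod_cast Nat.lt_succ_self k)
    refine ⟨hm.sub_of_left hlt, ?_, ?_⟩
    · rw [continuant, natDegree_eq_of_degree_eq (degree_sub_eq_left_of_degree_lt hlt), hd]
    · rw [degree_eq_natDegree h1.ne_zero, h2]
      exact_mod_cast Nat.lt_succ_self k

theorem discPoly_monic {R : Type*} [CommRing R] [Nontrivial R] (V : ℤ → R) {q : ℕ} (hq : 0 < q) :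
    (discPoly V q).Monic ∧ (discPoly V q).natDegree = q := by
  obtain ⟨k, rfl⟩ : ∃ k, q = k + 1 := ⟨q - 1, by omega⟩
  have e1 : fund (fun n => X - C (V n)) 0 (0 + ((k + 1 : ℕ) : ℤ) + 1)
      = continuant (fun n => X - C (V n)) 0 (k + 1 + 1) := by
    rw [← fund_add_nat]
    push_cast
    ring_nf
  have e2 : fund (fun n => X - C (V n)) (0 + 1) (0 + ((k + 1 : ℕ) : ℤ))
      = continuant (fun n => X - C (V n)) 1 k := by
    rw [← fund_add_nat]
    push_cast
    ring_nf
  obtain ⟨h1, h2, -⟩ := continuant_monic V 0 (k + 1)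
  obtain ⟨-, -, h3⟩ := continuant_monic V 1 k
  have hlt : (continuant (fun n => X - C (V n)) 1 k).degree
      < (continuant (fun n => X - C (V n)) 0 (k + 1 + 1)).degree := by
    rw [degree_eq_natDegree h1.ne_zero, h2]
    exact h3.trans (by exact_mod_cast Nat.lt_succ_self k)
  rw [discPoly, disc, e1, e2]
  exact ⟨h1.sub_of_left hlt, by
    rw [natDegree_eq_of_degree_eq (degree_sub_eq_left_of_degree_lt hlt), h2]⟩

/-- A Bloch solution with unimodular multiplier has real energy. -/
theorem im_eq_zero_of_bloch {V : ℤ → ℝ} {q : ℕ} (hq : 0 < q) {ζ E : ℂ} (hζ : ‖ζ‖ = 1) {u : ℤ → ℂ}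
    (hu : IsSol (fun n => E - (V n : ℂ)) u) (hper : ∀ n, u (n + q) = ζ * u n) (hne : u ≠ 0) :
    E.im = 0 := by
  have hζ' : ζ * starRingEnd ℂ ζ = 1 := by rw [Complex.mul_conj, Complex.normSq_eq_norm_sq, hζ]; simp
  set v : ℤ → ℂ := fun n => starRingEnd ℂ (u n) with hv
  have hvs : ∀ n, v (n + 1) + v (n - 1) = (starRingEnd ℂ E - (V n : ℂ)) * v n := by
    intro n
    have h := congrArg (starRingEnd ℂ) (hu n)
    simpa [hv] using h
  have hlag := lagrange_identity u v 0 q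
  have hs : ∀ k, u k * (v (k + 1) + v (k - 1)) - v k * (u (k + 1) + u (k - 1))
      = (starRingEnd ℂ E - E) * ((Complex.normSq (u k) : ℝ) : ℂ) := by
    intro k
    rw [hvs, hu, ← Complex.mul_conj]
    simp only [hv]
    ring
  have hw : wronsk u v (0 + (q : ℤ)) = wronsk u v 0 := by
    have h1 := hper 0
    have h2 := hper 1
    rw [add_comm] at h2
    simp only [wronsk, hv, zero_add] at h1 ⊢
    rw [h1, h2, map_mul, map_mul]
    linear_combination (u 0 * starRingEnd ℂ (u 1) - u 1 * starRingEnd ℂ (u 0)) * hζ'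
  rw [hw, sub_self] at hlag
  simp only [hs, zero_add] at hlag
  rw [← Finset.mul_sum] at hlag
  rcases mul_eq_zero.1 hlag with h | h
  · have h1 := congrArg Complex.im h
    simp at h1
    linarith
  · exfalso
    rw [← Complex.ofReal_sum, Complex.ofReal_eq_zero,
      Finset.sum_eq_zero_iff_of_nonneg fun i _ => Complex.normSq_nonneg _] at h
    have h1 : u 1 = 0 := by simpa using h 0 (by simpa using hq)
    have h2 : u (1 + 1) = 0 := by
      rcases Nat.lt_or_ge 1 q with h3 | h3
      · simpa using h 1 (by simpa using h3)
      · have : q = 1 := by omega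
        subst this
        rw [← Nat.cast_one (R := ℤ), Nat.cast_one, ← Nat.cast_one (R := ℤ)]
        have h4 := hper 1
        rw [h1, mul_zero] at h4
        exact h4
    exact hne (funext fun n => hu.eq_zero h1 h2 n)

theorem exists_unimodular {t : ℝ} (ht : |t| ≤ 2) : ∃ ζ : ℂ, ‖ζ‖ = 1 ∧ (t : ℂ) = ζ + ζ⁻¹ := by
  obtain ⟨h1, h2⟩ := abs_le.1 ht
  refine ⟨Complex.exp (Real.arccos (t / 2) * Complex.I), Complex.norm_exp_ofReal_mul_I _, ?_⟩
  rw [← Complex.exp_neg, ← neg_mul, ← Complex.two_cos, ← Complex.ofReal_cos,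
    Real.cos_arccos (by linarith) (by linarith)]
  push_cast
  ring

/-- A real polynomial all of whose complex roots are real splits. -/
theorem splits_of_forall_root_real {f : ℝ[X]} (hf : f ≠ 0)
    (h : ∀ z : ℂ, aeval z f = 0 → z.im = 0) : f.Splits := by
  refine (IsAlgClosed.splits (f.map (algebraMap ℝ ℂ))).of_splits_map (algebraMap ℝ ℂ) ?_
  intro z hz
  rw [mem_roots (map_ne_zero hf), IsRoot, eval_map_algebraMap] at hz
  exact ⟨z.re, by rw [Complex.coe_algebraMap]; exact Complex.ext (by simp) (by simp [h z hz])⟩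

theorem discPoly_sub_splits {V : ℤ → ℝ} {q : ℕ} (hq : 0 < q) (hV : ∀ n, V (n + q) = V n) {t : ℝ}
    (ht : |t| ≤ 2) : (discPoly V q - C t).Splits := by
  obtain ⟨hm, hd⟩ := discPoly_monic V hq
  refine splits_of_forall_root_real (fun h0 => ?_) fun z hz => ?_
  · have := natDegree_sub_C (p := discPoly V q) (a := t)
    rw [h0, natDegree_zero] at this
    omega
  · obtain ⟨ζ, hζ, hζt⟩ := exists_unimodular ht
    have h1 : disc (fun n => z - (V n : ℂ)) q 0 = ζ + ζ⁻¹ := by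
      have h2 : aeval z (discPoly V q) = disc (fun n => z - (V n : ℂ)) q 0 := by
        rw [discPoly, ← AlgHom.coe_toRingHom, map_disc]
        simp
      rw [map_sub, aeval_C, sub_eq_zero, h2] at hz
      rw [hz, ← hζt]
      rfl
    obtain ⟨u, hu0, hu, hup⟩ := exists_bloch (d := fun n => z - (V n : ℂ)) (q := q) (ζ := ζ)
      (by simp [hV]) (by rintro rfl; simp at hζ) h1
    exact im_eq_zero_of_bloch hq hζ hu hup hu0

/-- Laguerre's inequality for a product of real linear factors. -/
theorem laguerre_prod (s : Multiset ℝ) (x : ℝ) :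
    let f := (s.map fun a => X - C a).prod
    0 ≤ (derivative f).eval x ^ 2 - f.eval x * (derivative (derivative f)).eval x ∧
      (s ≠ 0 → f.eval x ≠ 0 →
        0 < (derivative f).eval x ^ 2 - f.eval x * (derivative (derivative f)).eval x) := by
  induction s using Multiset.induction_on with
  | empty => simp
  | cons a s ih =>
    obtain ⟨h1, -⟩ := ih
    simp only [Multiset.map_cons, Multiset.prod_cons]
    set f := (s.map fun a => X - C a).prod
    have e : (derivative ((X - C a) * f)).eval x ^ 2
        - ((X - C a) * f).eval x * (derivative (derivative ((X - C a) * f))).eval x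
        = f.eval x ^ 2 + (x - a) ^ 2 *
          ((derivative f).eval x ^ 2 - f.eval x * (derivative (derivative f)).eval x) := by
      simp only [derivative_mul, derivative_sub, derivative_X, derivative_C, derivative_add,
        eval_add, eval_mul, eval_sub, eval_X, eval_C, sub_zero, one_mul]
      ring
    refine ⟨by rw [e]; positivity, fun _ hne => ?_⟩
    rw [e]
    rw [eval_mul] at hne
    have := right_ne_zero_of_mul hne
    positivity

/-- If all levels of `P` near the value `P x` are real-rooted, then `x` is not a critical point:
Laguerre's inequality at a critical point, applied to slightly higher and slightly lower levels,
gives contradictory signs for the second derivative. -/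
theorem derivative_ne_zero_of_splits {P : ℝ[X]} {M x : ℝ} (hm : P.Monic) (hd : 0 < P.natDegree)
    (hP : ∀ t, |t| ≤ M → (P - C t).Splits) (hx : |P.eval x| < M) :
    (derivative P).eval x ≠ 0 := by
  intro h0
  have key : ∀ t, |t| ≤ M → P.eval x ≠ t →
      0 < -((P.eval x - t) * (derivative (derivative P)).eval x) := by
    intro t ht hne
    have hmt : (P - C t).Monic := hm.sub_of_left
      (degree_C_le.trans_lt (natDegree_pos_iff_degree_pos.1 hd))
    have hprod := (hP t ht).eq_prod_roots_of_monic hmt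
    have h1 := (laguerre_prod (P - C t).roots x).2 (fun h => by
      have h2 := (hP t ht).natDegree_eq_card_roots
      rw [natDegree_sub_C, h] at h2
      simp at h2
      omega)
    rw [← hprod] at h1
    simpa [h0] using h1 (by simpa [sub_eq_zero] using hne)
  obtain ⟨h1, h2⟩ := abs_lt.1 hx
  have h3 := key ((P.eval x + M) / 2) (abs_le.2 ⟨by linarith, by linarith⟩) (by linarith)
  have h4 := key ((P.eval x - M) / 2) (abs_le.2 ⟨by linarith, by linarith⟩) (by linarith)
  nlinarith

theorem card_roots_of_splits {f : ℝ[X]} (hf : f.Splits) (hf0 : f ≠ 0)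
    (h : ∀ x, f.eval x = 0 → (derivative f).eval x ≠ 0) : f.roots.toFinset.card = f.natDegree := by
  rw [Multiset.toFinset_card_of_nodup, ← hf.natDegree_eq_card_roots]
  rw [Multiset.nodup_iff_count_le_one]
  intro x
  rw [count_roots]
  by_contra! hlt
  obtain ⟨h1, h2⟩ := (one_lt_rootMultiplicity_iff_isRoot hf0).1 hlt
  exact h x h1 h2

end RealRooted

/-! ### The spectrum on `ℓ²(ℤ)` -/

section Spectrum

/-- The real-valued almost Mathieu potential. -/
def amReal (α lam θ : ℝ) (n : ℤ) : ℝ := 2 * lam * Real.cos (2 * Real.pi * (n * α + θ))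

theorem amPotential_eq_ofReal (α lam θ : ℝ) (n : ℤ) :
    amPotential α lam θ n = (amReal α lam θ n : ℂ) := rfl

theorem memlp_mul_bounded {c : ℤ → ℂ} {K : ℝ} (hc : ∀ n, ‖c n‖ ≤ K) (ψ : EllTwo) :
    Memℓp (E := fun _ : ℤ => ℂ) (fun n => c n * (ψ : ℤ → ℂ) n) 2 := by
  have hK : 0 ≤ K := (norm_nonneg _).trans (hc 0)
  have h := (lp.memℓp ψ).const_smul ((K : ℝ) : ℂ)
  rw [memℓp_gen_iff (p := 2) (by simp)] at h ⊢
  refine Summable.of_nonneg_of_le (fun n => by positivity) (fun n => ?_) h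
  refine Real.rpow_le_rpow (norm_nonneg _) ?_ (by simp)
  rw [Pi.smul_apply, smul_eq_mul, norm_mul, norm_mul, Complex.norm_real, Real.norm_eq_abs,
    abs_of_nonneg hK]
  exact mul_le_mul_of_nonneg_right (hc n) (norm_nonneg _)

/-- Multiplication by a bounded sequence as a bounded operator on `ℓ²(ℤ)`. -/
def mulCLM (c : ℤ → ℂ) (K : ℝ) (hc : ∀ n, ‖c n‖ ≤ K) : EllTwo →L[ℂ] EllTwo :=
  LinearMap.mkContinuous
    { toFun := fun ψ => ⟨fun n => c n * (ψ : ℤ → ℂ) n, memlp_mul_bounded hc ψ⟩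
      map_add' := fun ψ χ => by
        ext n
        exact mul_add _ _ _
      map_smul' := fun a ψ => by
        ext n
        exact mul_left_comm _ _ _ } K (by
    intro ψ
    have hK : 0 ≤ K := (norm_nonneg _).trans (hc 0)
    have hn : ‖((K : ℝ) : ℂ) • ψ‖ = K * ‖ψ‖ := by
      rw [norm_smul, Complex.norm_real, Real.norm_eq_abs, abs_of_nonneg hK]
    rw [← hn]
    refine lp.norm_mono (by simp) (fun n => ?_)
    rw [lp.coeFn_smul, Pi.smul_apply, smul_eq_mul, norm_mul, Complex.norm_real,
      Real.norm_eq_abs, abs_of_nonneg hK]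
    exact (norm_mul_le _ _).trans (mul_le_mul_of_nonneg_right (hc n) (norm_nonneg _)))

theorem translateCLM_apply (k : ℤ) (ψ : EllTwo) (n : ℤ) :
    (translateCLM k ψ : ℤ → ℂ) n = (ψ : ℤ → ℂ) (n + k) := rfl

theorem norm_translateCLM_le (k : ℤ) : ‖translateCLM k‖ ≤ 1 :=
  LinearMap.mkContinuous_norm_le _ zero_le_one _

theorem sub_almostMathieu_apply (α lam θ : ℝ) (E : ℝ) (ψ : EllTwo) (n : ℤ) :
    (((algebraMap ℝ (EllTwo →L[ℂ] EllTwo) E - almostMathieu α lam θ) ψ : EllTwo) : ℤ → ℂ) n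
      = ((E : ℂ) - (amReal α lam θ n : ℂ)) * (ψ : ℤ → ℂ) n - (ψ : ℤ → ℂ) (n + 1)
        - (ψ : ℤ → ℂ) (n - 1) := by
  have h : (((algebraMap ℝ (EllTwo →L[ℂ] EllTwo) E - almostMathieu α lam θ) ψ : EllTwo) : ℤ → ℂ) n
      = (E : ℂ) * (ψ : ℤ → ℂ) n
        - ((ψ : ℤ → ℂ) (n + 1) + (ψ : ℤ → ℂ) (n - 1) + amPotential α lam θ n * (ψ : ℤ → ℂ) n) := by
    rw [Algebra.algebraMap_eq_smul_one]
    rfl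
  rw [h, amPotential_eq_ofReal]
  ring

theorem isSelfAdjoint_almostMathieu (α lam θ : ℝ) : IsSelfAdjoint (almostMathieu α lam θ) := by
  have ht : ∀ k : ℤ, star (translateCLM k) = translateCLM (-k) := by
    intro k
    refine Eq.symm ((ContinuousLinearMap.eq_adjoint_iff _ _).2 fun x y => ?_)
    rw [lp.inner_eq_tsum, lp.inner_eq_tsum,
      ← (Equiv.addRight k).tsum_eq]
    refine tsum_congr fun n => ?_
    rw [translateCLM_apply, translateCLM_apply, Equiv.coe_addRight, add_neg_cancel_right]
  have hp : star (potentialCLM α lam θ) = potentialCLM α lam θ := by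
    refine Eq.symm ((ContinuousLinearMap.eq_adjoint_iff _ _).2 fun x y => ?_)
    rw [lp.inner_eq_tsum, lp.inner_eq_tsum]
    refine tsum_congr fun n => ?_
    change inner ℂ (amPotential α lam θ n * (x : ℤ → ℂ) n) ((y : ℤ → ℂ) n)
      = inner ℂ ((x : ℤ → ℂ) n) (amPotential α lam θ n * (y : ℤ → ℂ) n)
    simp only [RCLike.inner_apply, map_mul, amPotential, Complex.conj_ofReal]
    ring
  rw [IsSelfAdjoint, almostMathieu, star_add, star_add, ht, ht, hp, neg_neg,
    add_comm (translateCLM (-1))]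

theorem isSelfAdjoint_sub_almostMathieu (α lam θ E : ℝ) :
    IsSelfAdjoint (algebraMap ℝ (EllTwo →L[ℂ] EllTwo) E - almostMathieu α lam θ) := by
  refine IsSelfAdjoint.sub ?_ (isSelfAdjoint_almostMathieu α lam θ)
  rw [IsScalarTower.algebraMap_apply ℝ ℂ (EllTwo →L[ℂ] EllTwo)]
  exact IsSelfAdjoint.algebraMap _ (Complex.conj_ofReal E)

/-- The sequence `disc * ψ n - ψ (n - q) - ψ (n + q)` is a finite combination, with periodic
coefficients, of translates of the sequence `d ψ - ψ (· + 1) - ψ (· - 1)`. -/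
theorem disc_mul_sub_translates {R : Type*} [CommRing R] {d : ℤ → R} {q : ℕ}
    (hd : ∀ n, d (n + q) = d n) (ψ : ℤ → R) (n : ℤ) :
    disc d q 0 * ψ n - ψ (n - q) - ψ (n + q) = ∑ i ∈ Finset.range q,
      (fund d (n - q) (n - q + (i + 1)) * (d (n - q + (i + 1)) * ψ (n - q + (i + 1))
          - ψ (n - q + (i + 1) + 1) - ψ (n - q + (i + 1) - 1))
        + fund d (n + (i + 1)) (n + q) * (d (n + (i + 1)) * ψ (n + (i + 1))
          - ψ (n + (i + 1) + 1) - ψ (n + (i + 1) - 1))) := by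
  have h1 := lagrange_identity ψ (fund d (n - q)) (n - q) q
  have h2 := lagrange_identity ψ (fun a => fund d a (n + q)) n q
  simp only [isSol_fund d (n - q) _] at h1
  have h3 : ∀ k, fund d (k + 1) (n + q) + fund d (k - 1) (n + q) = d k * fund d k (n + q) :=
    isSol_fund_left d (n + q)
  simp only [h3] at h2
  have e1 : fund d (n + 1) (n + q) = fund d (n - q + 1) n := by
    have h := fund_add_period hd (n - q + 1) n
    rw [← h]
    congr 1
    ring
  have e2 : fund d n (n + q) = fund d (n - q) n := by
    have h := fund_add_period hd (n - q) n
    rw [← h]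
    congr 1
    ring
  rw [disc_eq_disc hd 0 (n - q), disc, Finset.sum_add_distrib]
  simp only [wronsk, sub_add_cancel, fund_self, fund_succ, fund_succ_left, e1, e2] at h1 h2 ⊢
  have e3 : ∑ i ∈ Finset.range q, fund d (n - q) (n - q + (i + 1)) *
      (d (n - q + (i + 1)) * ψ (n - q + (i + 1)) - ψ (n - q + (i + 1) + 1)
        - ψ (n - q + (i + 1) - 1))
      = ψ n * fund d (n - q) (n + 1) - fund d (n - q) n * ψ (n + 1) - ψ (n - q) := by
    rw [mul_one, zero_mul, sub_zero] at h1
    rw [← h1]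
    exact Finset.sum_congr rfl fun i _ => by ring
  have e4 : ∑ i ∈ Finset.range q, fund d (n + (i + 1)) (n + q) *
      (d (n + (i + 1)) * ψ (n + (i + 1)) - ψ (n + (i + 1) + 1) - ψ (n + (i + 1) - 1))
      = -ψ (n + q) - (ψ n * fund d (n - q + 1) n - fund d (n - q) n * ψ (n + 1)) := by
    rw [mul_neg_one, zero_mul, sub_zero] at h2
    rw [← h2]
    exact Finset.sum_congr rfl fun i _ => by ring
  rw [e3, e4]
  ring

theorem exists_bound_of_periodic {c : ℤ → ℂ} {q : ℕ} (hq : 0 < q) (hc : ∀ n, c (n + q) = c n) :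
    ∃ K : ℝ, ∀ n, ‖c n‖ ≤ K := by
  refine ⟨∑ i ∈ Finset.range q, ‖c i‖, fun n => ?_⟩
  have hper : Function.Periodic c (q : ℤ) := hc
  have e1 := Int.emod_nonneg n (show (q : ℤ) ≠ 0 by omega)
  have e2 := Int.emod_lt_of_pos n (show (0 : ℤ) < q by omega)
  have h2 := hper.sub_zsmul_eq (x := n) (n / q)
  rw [smul_eq_mul, mul_comm, ← Int.emod_def] at h2
  rw [← h2]
  have h3 := Finset.single_le_sum (f := fun i : ℕ => ‖c i‖) (s := Finset.range q)
    (fun i _ => norm_nonneg _) (a := (n % q).toNat) (by rw [Finset.mem_range]; omega)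
  rwa [Int.toNat_of_nonneg e1] at h3

variable {α lam θ E : ℝ} {q : ℕ}

theorem ofReal_disc (V : ℤ → ℝ) (E : ℝ) (q : ℕ) :
    ((disc (fun n => E - V n) q 0 : ℝ) : ℂ) = disc (fun n => (E : ℂ) - (V n : ℂ)) q 0 := by
  have h := map_disc Complex.ofRealHom (fun n => E - V n) q 0
  simpa using h

/-- Energies at which the discriminant exceeds `2` in absolute value are not in the spectrum:
`disc - T ^ q - T ^ (-q)`, with `T` the translation, is invertible, and it is a left multiple of
`E - H`. -/
theorem isUnit_of_two_lt_abs_disc (hq : 0 < q)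
    (hper : ∀ n, amReal α lam θ (n + q) = amReal α lam θ n)
    (h : 2 < |disc (fun n => E - amReal α lam θ n) q 0|) :
    IsUnit (algebraMap ℝ (EllTwo →L[ℂ] EllTwo) E - almostMathieu α lam θ) := by
  set A := algebraMap ℝ (EllTwo →L[ℂ] EllTwo) E - almostMathieu α lam θ with hA
  set d : ℤ → ℂ := fun n => (E : ℂ) - (amReal α lam θ n : ℂ) with hd
  have hdper : ∀ n, d (n + q) = d n := fun n => by simp [hd, hper]
  set D : ℂ := disc d q 0 with hD
  have hDn : 2 < ‖D‖ := by
    rw [hD, hd, ← ofReal_disc, Complex.norm_real]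
    exact h
  have hc1 : ∀ i : ℕ, ∃ K : ℝ, ∀ n : ℤ, ‖fund d (n - q) (n - q + (i + 1))‖ ≤ K := fun i =>
    exists_bound_of_periodic hq fun n => by
      have e := fund_add_period hdper (n - q) (n - q + (i + 1))
      rw [← e]
      congr 1 <;> ring
  have hc2 : ∀ i : ℕ, ∃ K : ℝ, ∀ n : ℤ, ‖fund d (n + (i + 1)) (n + q)‖ ≤ K := fun i =>
    exists_bound_of_periodic hq fun n => by
      have e := fund_add_period hdper (n + (i + 1)) (n + q)
      rw [← e]
      congr 1
      ring
  choose K₁ hK₁ using hc1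
  choose K₂ hK₂ using hc2
  set B : EllTwo →L[ℂ] EllTwo := ∑ i ∈ Finset.range q,
    (mulCLM (fun n => fund d (n - q) (n - q + (i + 1))) (K₁ i) (hK₁ i)
        * translateCLM (-(q : ℤ) + (i + 1))
      + mulCLM (fun n => fund d (n + (i + 1)) (n + q)) (K₂ i) (hK₂ i)
        * translateCLM ((i : ℤ) + 1)) with hB
  have hBA : B * A = algebraMap ℂ (EllTwo →L[ℂ] EllTwo) D
      - (translateCLM (q : ℤ) + translateCLM (-(q : ℤ))) := by
    ext ψ n
    have h1 : (((algebraMap ℂ (EllTwo →L[ℂ] EllTwo) D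
        - (translateCLM (q : ℤ) + translateCLM (-(q : ℤ)))) ψ : EllTwo) : ℤ → ℂ) n
        = D * (ψ : ℤ → ℂ) n - ((ψ : ℤ → ℂ) (n + q) + (ψ : ℤ → ℂ) (n + -q)) := by
      rw [Algebra.algebraMap_eq_smul_one]
      rfl
    have h2 : (((B * A) ψ : EllTwo) : ℤ → ℂ) n = ∑ i ∈ Finset.range q,
        (fund d (n - q) (n - q + (i + 1)) * ((A ψ : EllTwo) : ℤ → ℂ) (n + (-(q : ℤ) + (i + 1)))
          + fund d (n + (i + 1)) (n + q) * ((A ψ : EllTwo) : ℤ → ℂ) (n + ((i : ℤ) + 1))) := by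
      rw [mul_apply_eq_comp, hB, sum_apply, lp.coeFn_sum,
        Finset.sum_apply]
      rfl
    rw [h1, h2, ← sub_eq_add_neg, ← sub_sub, sub_right_comm, disc_mul_sub_translates hdper]
    refine Finset.sum_congr rfl fun i _ => ?_
    rw [hA, sub_almostMathieu_apply, sub_almostMathieu_apply, ← add_assoc, ← sub_eq_add_neg]
  have hX : IsUnit (B * A) := by
    rw [hBA]
    refine spectrum.mem_resolventSet_of_norm_lt_mul (𝕜 := ℂ) ?_
    have h1 := norm_add_le (translateCLM (q : ℤ)) (translateCLM (-(q : ℤ)))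
    have h2 := norm_translateCLM_le (q : ℤ)
    have h3 := norm_translateCLM_le (-(q : ℤ))
    have h4 : ‖(1 : EllTwo →L[ℂ] EllTwo)‖ ≤ 1 := ContinuousLinearMap.norm_id_le
    nlinarith [norm_nonneg (translateCLM (q : ℤ) + translateCLM (-(q : ℤ))),
      norm_nonneg (1 : EllTwo →L[ℂ] EllTwo)]
  obtain ⟨C, hC⟩ := hX.exists_left_inv
  rw [← mul_assoc] at hC
  refine isUnit_iff_exists_and_exists.2 ⟨⟨star (C * B), ?_⟩, ⟨C * B, hC⟩⟩
  have h1 := congrArg star hC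
  rwa [star_mul, star_one, (isSelfAdjoint_sub_almostMathieu α lam θ E).star_eq] at h1

/-- Energies at which the discriminant is at most `2` in absolute value are in the spectrum:
truncations of a Bloch solution are approximate eigenvectors. -/
theorem not_isUnit_of_abs_disc_le_two (hq : 0 < q)
    (hper : ∀ n, amReal α lam θ (n + q) = amReal α lam θ n)
    (h : |disc (fun n => E - amReal α lam θ n) q 0| ≤ 2) :
    ¬ IsUnit (algebraMap ℝ (EllTwo →L[ℂ] EllTwo) E - almostMathieu α lam θ) := by
  intro hunit
  set A := algebraMap ℝ (EllTwo →L[ℂ] EllTwo) E - almostMathieu α lam θ with hA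
  obtain ⟨ζ, hζ, hζt⟩ := exists_unimodular h
  rw [ofReal_disc] at hζt
  obtain ⟨u, hu0, hu, hup⟩ := exists_bloch (by simp [hper]) (by rintro rfl; simp at hζ) hζt
  obtain ⟨a, ha⟩ : ∃ a, u a ≠ 0 := by
    by_contra! h0
    exact hu0 (funext h0)
  have hnorm : ∀ (k : ℕ) (n : ℤ), ‖u (n + k * q)‖ = ‖u n‖ := by
    intro k n
    induction k with
    | zero => simp
    | succ k ih =>
      rw [show n + ((k + 1 : ℕ) : ℤ) * q = n + k * q + q by push_cast; ring, hup, norm_mul, hζ,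
        one_mul, ih]
  obtain ⟨C, hC⟩ := hunit.exists_left_inv
  have hlow : ∀ ψ : EllTwo, ‖ψ‖ ≤ ‖C‖ * ‖A ψ‖ := by
    intro ψ
    have h1 : C (A ψ) = ψ := by rw [← mul_apply_eq_comp, hC]; rfl
    calc ‖ψ‖ = ‖C (A ψ)‖ := by rw [h1]
      _ ≤ _ := C.le_opNorm _
  have hmem : ∀ M : ℕ, Memℓp (E := fun _ : ℤ => ℂ)
      (fun n => if a ≤ n ∧ n < a + M then u n else 0) 2 := by
    intro M
    refine (memℓp_zero ?_).of_exponent_ge zero_le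
    refine (Set.finite_Ico a (a + M)).subset fun n hn => ?_
    by_contra hcon
    exact hn (if_neg hcon)
  set S := 2 * (‖u a‖ + ‖u (a - 1)‖) with hS
  have hkey : ∀ N : ℕ, 0 < N → (N : ℝ) * ‖u a‖ ^ 2 ≤ (‖C‖ * S) ^ 2 := by
    intro N hN
    set ψ : EllTwo := ⟨_, hmem (N * q)⟩ with hψ
    have hψn : ∀ n, (ψ : ℤ → ℂ) n = if a ≤ n ∧ n < a + ((N * q : ℕ) : ℤ) then u n else 0 :=
      fun _ => rfl
    have hM : (1 : ℤ) ≤ ((N * q : ℕ) : ℤ) := by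
      have : 0 < N * q := Nat.mul_pos hN hq
      omega
    have hAψ : A ψ = lp.single 2 a (u (a - 1)) - lp.single 2 (a - 1) (u a)
        + (lp.single 2 (a + ((N * q : ℕ) : ℤ) - 1) (u (a + ((N * q : ℕ) : ℤ)))
          - lp.single 2 (a + ((N * q : ℕ) : ℤ)) (u (a + ((N * q : ℕ) : ℤ) - 1))) := by
      ext n
      rw [hA, sub_almostMathieu_apply, hψn, hψn, hψn]
      simp only [lp.coeFn_add, lp.coeFn_sub, Pi.add_apply, Pi.sub_apply, lp.single_apply,
        Pi.single_apply]
      generalize ((N * q : ℕ) : ℤ) = M at hM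
      have hun := hu n
      have c1 : (a ≤ n ∧ n < a + M) ∨ n < a ∨ a + M ≤ n := by omega
      rcases c1 with c1 | c1 | c1
      · rw [if_pos c1, if_neg (show n ≠ a - 1 by omega), if_neg (show n ≠ a + M by omega)]
        by_cases c2 : n = a <;> by_cases c3 : n = a + M - 1
        · rw [if_neg (by omega), if_neg (by omega), if_pos c2, if_pos c3]
          rw [show a - 1 = n - 1 by omega, show a + M = n + 1 by omega]
          linear_combination -hun
        · rw [if_pos (by omega), if_neg (by omega), if_pos c2, if_neg c3]
          rw [show a - 1 = n - 1 by omega]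
          linear_combination -hun
        · rw [if_neg (by omega), if_pos (by omega), if_neg c2, if_pos c3]
          rw [show a + M = n + 1 by omega]
          linear_combination -hun
        · rw [if_pos (by omega), if_pos (by omega), if_neg c2, if_neg c3]
          linear_combination -hun
      · rw [if_neg (show ¬ (a ≤ n ∧ n < a + M) by omega),
          if_neg (show ¬ (a ≤ n - 1 ∧ n - 1 < a + M) by omega), if_neg (show n ≠ a by omega),
          if_neg (show n ≠ a + M by omega), if_neg (show n ≠ a + M - 1 by omega)]
        by_cases c2 : n = a - 1
        · rw [if_pos (by omega), if_pos c2, show n + 1 = a by omega]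
          ring
        · rw [if_neg (by omega), if_neg c2]
          ring
      · rw [if_neg (show ¬ (a ≤ n ∧ n < a + M) by omega),
          if_neg (show ¬ (a ≤ n + 1 ∧ n + 1 < a + M) by omega), if_neg (show n ≠ a by omega),
          if_neg (show n ≠ a - 1 by omega), if_neg (show n ≠ a + M - 1 by omega)]
        by_cases c2 : n = a + M
        · rw [if_pos (by omega), if_pos c2, show a + M - 1 = n - 1 by omega]
          ring
        · rw [if_neg (by omega), if_neg c2]
          ring
    have hup1 : ‖A ψ‖ ≤ S := by
      have e1 : ‖u (a + ((N * q : ℕ) : ℤ))‖ = ‖u a‖ := by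
        push_cast
        exact hnorm N a
      have e2 : ‖u (a + ((N * q : ℕ) : ℤ) - 1)‖ = ‖u (a - 1)‖ := by
        rw [show a + ((N * q : ℕ) : ℤ) - 1 = a - 1 + N * q by push_cast; ring]
        exact hnorm N (a - 1)
      rw [hAψ]
      refine (norm_add_le _ _).trans ?_
      have h1 := norm_sub_le (lp.single (E := fun _ : ℤ => ℂ) 2 a (u (a - 1)))
        (lp.single 2 (a - 1) (u a))
      have h2 := norm_sub_le (lp.single (E := fun _ : ℤ => ℂ) 2 (a + ((N * q : ℕ) : ℤ) - 1)
        (u (a + ((N * q : ℕ) : ℤ)))) (lp.single 2 (a + ((N * q : ℕ) : ℤ))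
          (u (a + ((N * q : ℕ) : ℤ) - 1)))
      rw [lp.norm_single (by norm_num), lp.norm_single (by norm_num)] at h1 h2
      rw [e1, e2] at h2
      rw [hS]
      linarith
    have hlow1 : (N : ℝ) * ‖u a‖ ^ 2 ≤ ‖ψ‖ ^ 2 := by
      have h1 := lp.sum_rpow_le_norm_rpow (p := 2) (by simp) ψ
        ((Finset.range N).image fun k : ℕ => a + (k : ℤ) * q)
      rw [Finset.sum_image (by
        intro i _ j _ hij
        have h2 : (i : ℤ) * q = j * q := by simpa using hij
        have h3 := mul_right_cancel₀ (show (q : ℤ) ≠ 0 by omega) h2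
        exact_mod_cast h3)] at h1
      have h2 : ∀ k ∈ Finset.range N, ‖(ψ : ℤ → ℂ) (a + (k : ℤ) * q)‖ ^ (2 : ENNReal).toReal
          = ‖u a‖ ^ 2 := by
        intro k hk
        rw [Finset.mem_range] at hk
        have h3 : (k : ℤ) * q + q ≤ N * q := by
          have : k * q + q ≤ N * q := by nlinarith
          exact_mod_cast this
        rw [hψn, if_pos ⟨by nlinarith [Int.natCast_nonneg (k * q)], by push_cast; omega⟩, hnorm]
        simp
      rw [Finset.sum_congr rfl h2] at h1
      simpa using h1
    calc (N : ℝ) * ‖u a‖ ^ 2 ≤ ‖ψ‖ ^ 2 := hlow1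
      _ ≤ (‖C‖ * S) ^ 2 := by
        have h1 := hlow ψ
        have h2 : ‖C‖ * ‖A ψ‖ ≤ ‖C‖ * S := mul_le_mul_of_nonneg_left hup1 (norm_nonneg _)
        exact pow_le_pow_left₀ (norm_nonneg _) (h1.trans h2) 2
  have hpos : 0 < ‖u a‖ ^ 2 := by positivity
  obtain ⟨N, hN⟩ := exists_nat_gt ((‖C‖ * S) ^ 2 / ‖u a‖ ^ 2)
  rw [div_lt_iff₀ hpos] at hN
  have hN0 : 0 < N := by
    rcases Nat.eq_zero_or_pos N with h0 | h0
    · subst h0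
      simp only [Nat.cast_zero, zero_mul] at hN
      exact absurd hN (not_lt.2 (sq_nonneg _))
    · exact h0
  exact absurd (hkey N hN0) (not_le.2 hN)

theorem mem_amSpectrum_iff (hq : 0 < q) (hper : ∀ n, amReal α lam θ (n + q) = amReal α lam θ n) :
    E ∈ amSpectrum α lam θ ↔ |disc (fun n => E - amReal α lam θ n) q 0| ≤ 2 := by
  rw [amSpectrum, spectrum.mem_iff]
  constructor
  · intro h
    by_contra! hlt
    exact h (isUnit_of_two_lt_abs_disc hq hper hlt)
  · exact not_isUnit_of_abs_disc_le_two hq hper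

end Spectrum

/-! ### The intersection spectrum as a level set of one polynomial -/

section Level

variable {p : ℤ} {q : ℕ}

theorem chambers_one {ω : ℂ} (hω : IsPrimitiveRoot ω q) (hq : 0 < q) (lam E : ℂ) {w : ℂ}
    (hw : w ≠ 0) : disc (fun n => E - cosPotential ω lam w n) q 0
      = disc (fun n => E - cosPotential ω lam 1 n) q 0 + 2 * lam ^ q
        - lam ^ q * (w ^ q + (w ^ q)⁻¹) := by
  obtain ⟨P, hP⟩ := chambers hω hq lam E
  rw [hP w hw, hP 1 one_ne_zero]
  simp
  ring

/-- The rotation factor `e^{2 π i p / q}`. -/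
def rotationFactor (p : ℤ) (q : ℕ) : ℂ := Complex.exp (2 * Real.pi * Complex.I / q) ^ p

theorem isPrimitiveRoot_rotation (hq : 0 < q) (hpq : IsCoprime p (q : ℤ)) :
    IsPrimitiveRoot (rotationFactor p q) q :=
  (Complex.isPrimitiveRoot_exp q hq.ne').zpow_of_gcd_eq_one p (Int.isCoprime_iff_gcd_eq_one.1 hpq)

theorem amReal_eq_cosPotential (p : ℤ) (q : ℕ) (lam θ : ℝ) (n : ℤ) :
    (amReal ((p : ℝ) / q) lam θ n : ℂ) = cosPotential (rotationFactor p q) lam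
      (Complex.exp (2 * Real.pi * θ * Complex.I)) n := by
  have h : ∀ n : ℤ, rotationFactor p q ^ n
      = Complex.exp (2 * Real.pi * (n * ((p : ℝ) / q) : ℝ) * Complex.I) := by
    intro n
    rw [rotationFactor, ← Complex.exp_int_mul, ← Complex.exp_int_mul]
    congr 1
    push_cast
    ring
  rw [cosPotential, h, h, ← Complex.exp_neg, ← Complex.exp_add, ← Complex.exp_add, amReal]
  push_cast
  rw [mul_comm (2 : ℂ) lam, mul_assoc, Complex.two_cos]
  congr 3 <;> ring_nf

/-- The phase-independent part of the discriminant. At phase `0` the phase-dependent term is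
`-2 lam ^ q`. -/
def levelPoly (p : ℤ) (q : ℕ) (lam : ℝ) : ℝ[X] :=
  discPoly (amReal ((p : ℝ) / q) lam 0) q + C (2 * lam ^ q)

theorem disc_amReal (hq : 0 < q) (hpq : IsCoprime p (q : ℤ)) (lam θ E : ℝ) :
    disc (fun n => E - amReal ((p : ℝ) / q) lam θ n) q 0
      = (levelPoly p q lam).eval E - 2 * lam ^ q * Real.cos (2 * Real.pi * (q * θ)) := by
  have hω := isPrimitiveRoot_rotation hq hpq
  rw [levelPoly, eval_add, eval_discPoly, eval_C]
  apply Complex.ofReal_injective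
  push_cast
  rw [ofReal_disc, ofReal_disc]
  simp only [amReal_eq_cosPotential]
  rw [chambers_one hω hq _ _ (Complex.exp_ne_zero _), ← Complex.exp_nat_mul, ← Complex.exp_neg]
  rw [mul_comm (2 : ℂ) ((lam : ℂ) ^ q), mul_assoc _ (2 : ℂ) (Complex.cos _), Complex.two_cos]
  simp only [Complex.ofReal_zero, mul_zero, zero_mul, Complex.exp_zero]
  ring_nf

theorem discPoly_amReal (hq : 0 < q) (hpq : IsCoprime p (q : ℤ)) (lam θ : ℝ) :
    discPoly (amReal ((p : ℝ) / q) lam θ) q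
      = levelPoly p q lam - C (2 * lam ^ q * Real.cos (2 * Real.pi * (q * θ))) := by
  refine Polynomial.funext fun E => ?_
  rw [eval_discPoly, disc_amReal hq hpq, eval_sub, eval_C]

theorem exists_pow_add_inv (hq : 0 < q) (D : ℂ) : ∃ z : ℂ, z ≠ 0 ∧ D = z ^ q + (z ^ q)⁻¹ := by
  obtain ⟨ζ, hζ⟩ : ∃ ζ : ℂ, (X ^ 2 - C D * X + 1 : ℂ[X]).eval ζ = 0 := by
    refine IsAlgClosed.exists_root _ ?_
    have : (X ^ 2 - C D * X + 1 : ℂ[X]).degree = 2 := by compute_degree!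
    rw [this]
    norm_num
  simp only [eval_add, eval_sub, eval_pow, eval_X, eval_mul, eval_C, eval_one] at hζ
  have hζ0 : ζ ≠ 0 := by
    rintro rfl
    simp at hζ
  obtain ⟨z, hz⟩ := IsAlgClosed.exists_pow_nat_eq ζ hq
  refine ⟨z, ?_, ?_⟩
  · rintro rfl
    rw [zero_pow hq.ne'] at hz
    exact hζ0 hz.symm
  · rw [hz]
    field_simp
    linear_combination -hζ

/-- Aubry duality for the phase-independent part of the discriminant. -/
theorem levelPoly_dual (hq : 0 < q) (hpq : IsCoprime p (q : ℤ)) {lam : ℝ} (hlam : 0 < lam) (E : ℝ) :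
    lam ^ q * (levelPoly p q lam⁻¹).eval (lam⁻¹ * E) = (levelPoly p q lam).eval E := by
  have hω := isPrimitiveRoot_rotation hq hpq
  have hl : (lam : ℂ) ≠ 0 := by exact_mod_cast hlam.ne'
  have hlev : ∀ l E : ℝ, (((levelPoly p q l).eval E : ℝ) : ℂ)
      = disc (fun n => (E : ℂ) - cosPotential (rotationFactor p q) l 1 n) q 0 + 2 * (l : ℂ) ^ q := by
    intro l E
    rw [levelPoly, eval_add, eval_discPoly, eval_C]
    push_cast
    rw [ofReal_disc]
    simp only [amReal_eq_cosPotential, Complex.ofReal_zero, mul_zero, zero_mul, Complex.exp_zero]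
  obtain ⟨z, hz, hD⟩ := exists_pow_add_inv hq
    (disc (fun n => (E : ℂ) - cosPotential (rotationFactor p q) lam 1 n) q 0)
  have h1 := aubry_duality hω hq hl one_ne_zero hz hD
  have h2 := chambers_one hω hq ((lam : ℂ)⁻¹) ((lam : ℂ)⁻¹ * E) (inv_ne_zero hz)
  apply Complex.ofReal_injective
  push_cast
  rw [hlev, hlev, hD]
  push_cast
  rw [h1] at h2
  have hl' : (lam : ℂ) ^ q ≠ 0 := pow_ne_zero _ hl
  have hz' : z ^ q ≠ 0 := pow_ne_zero _ hz
  have h3 : disc (fun n => (lam : ℂ)⁻¹ * E - cosPotential (rotationFactor p q) (lam : ℂ)⁻¹ 1 n) q 0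
      + 2 * (lam : ℂ)⁻¹ ^ q = 2 + (lam : ℂ)⁻¹ ^ q * (z ^ q + (z ^ q)⁻¹) := by
    rw [inv_pow z, inv_inv] at h2
    simp only [one_pow, inv_one] at h2
    linear_combination -h2
  rw [h3, inv_pow]
  field_simp
  ring

theorem amReal_add_period (p : ℤ) (q : ℕ) (lam θ : ℝ) (n : ℤ) :
    amReal ((p : ℝ) / q) lam θ (n + q) = amReal ((p : ℝ) / q) lam θ n := by
  have h := amPotential_add p q lam θ n
  rw [amPotential_eq_ofReal, amPotential_eq_ofReal] at h
  exact_mod_cast h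

/-- At the dual coupling `1 / lam`, the constraints at the phases with `cos (2 π q θ) = ±1` imply those
at all other phases; duality turns the result into a level set of the polynomial for `lam`. -/
theorem intersectionSpectrum_eq (hq : 0 < q) (hpq : IsCoprime p (q : ℤ)) {lam : ℝ}
    (hlam : 1 < lam) : intersectionSpectrum ((p : ℝ) / q) lam
      = {E | |(levelPoly p q lam).eval E| ≤ 2 * lam ^ q - 2} := by
  have hlam0 : 0 < lam := by linarith
  have hq' : (q : ℝ) ≠ 0 := by exact_mod_cast hq.ne'
  have hinv : ∀ E : ℝ, (E ∈ ⋂ θ : ℝ, amSpectrum ((p : ℝ) / q) (1 / lam) θ)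
      ↔ |(levelPoly p q lam⁻¹).eval E| ≤ 2 - 2 * lam⁻¹ ^ q := by
    intro E
    rw [one_div, Set.mem_iInter]
    simp only [mem_amSpectrum_iff hq (amReal_add_period p q _ _), disc_amReal hq hpq]
    have hpos : 0 < lam⁻¹ ^ q := by positivity
    constructor
    · intro h
      have h0 := (abs_le.1 (h 0)).1
      have h1 := (abs_le.1 (h (1 / (2 * q)))).2
      rw [show 2 * Real.pi * (q * (1 / (2 * q))) = Real.pi by field_simp, Real.cos_pi] at h1
      rw [mul_zero, mul_zero, Real.cos_zero] at h0
      exact abs_le.2 ⟨by linarith, by linarith⟩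
    · intro h θ
      obtain ⟨h0, h1⟩ := abs_le.1 h
      have h2 := Real.neg_one_le_cos (2 * Real.pi * (q * θ))
      have h3 := Real.cos_le_one (2 * Real.pi * (q * θ))
      exact abs_le.2 ⟨by nlinarith, by nlinarith⟩
  rw [intersectionSpectrum, if_neg (by linarith)]
  ext E
  have hpow : 0 < lam ^ q := by positivity
  have hiff : ∀ E' : ℝ, |(levelPoly p q lam⁻¹).eval E'| ≤ 2 - 2 * lam⁻¹ ^ q
      ↔ |(levelPoly p q lam).eval (lam * E')| ≤ 2 * lam ^ q - 2 := by
    intro E'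
    rw [← levelPoly_dual hq hpq hlam0, inv_mul_cancel_left₀ hlam0.ne', abs_mul, abs_of_pos hpow,
      show 2 * lam ^ q - 2 = lam ^ q * (2 - 2 * lam⁻¹ ^ q) by rw [inv_pow]; field_simp,
      mul_le_mul_iff_right₀ hpow]
  constructor
  · rintro ⟨E', hE', rfl⟩
    exact (hiff E').1 ((hinv E').1 hE')
  · intro hE
    refine ⟨lam⁻¹ * E, (hinv _).2 ((hiff _).2 ?_), mul_inv_cancel_left₀ hlam0.ne' E⟩
    rw [mul_inv_cancel_left₀ hlam0.ne']
    exact hE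

theorem levelPoly_monic (hq : 0 < q) (p : ℤ) (lam : ℝ) :
    (levelPoly p q lam).Monic ∧ (levelPoly p q lam).natDegree = q := by
  obtain ⟨hm, hd⟩ := discPoly_monic (amReal ((p : ℝ) / q) lam 0) hq
  have hpos : 0 < (discPoly (amReal ((p : ℝ) / q) lam 0) q).natDegree := by rwa [hd]
  refine ⟨hm.add_of_left (degree_C_le.trans_lt (natDegree_pos_iff_degree_pos.1 hpos)), ?_⟩
  rw [levelPoly, natDegree_add_C, hd]

/-- Each level `t` with `|t| ≤ 2 + 2 lam ^ q` is of the form `2 lam ^ q x + 2 x` with `x ∈ [-1, 1]`;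
at a phase `θ` with `cos (2 π q θ) = x`, the level set of `P` is that of the discriminant at `2 x`. -/
theorem levelPoly_sub_splits (hq : 0 < q) (hpq : IsCoprime p (q : ℤ)) {lam : ℝ} (hlam : 0 < lam)
    {t : ℝ} (ht : |t| ≤ 2 + 2 * lam ^ q) : (levelPoly p q lam - C t).Splits := by
  have hM : 0 < 2 + 2 * lam ^ q := by positivity
  obtain ⟨h1, h2⟩ := abs_le.1 ht
  set x := t / (2 + 2 * lam ^ q) with hx
  have hx1 : -1 ≤ x := by rw [hx, le_div_iff₀ hM]; linarith
  have hx2 : x ≤ 1 := by rw [hx, div_le_iff₀ hM]; linarith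
  have hq' : (q : ℝ) ≠ 0 := by exact_mod_cast hq.ne'
  have hd := discPoly_amReal hq hpq lam (Real.arccos x / (2 * Real.pi * q))
  rw [show 2 * Real.pi * (q * (Real.arccos x / (2 * Real.pi * q))) = Real.arccos x by
    field_simp, Real.cos_arccos hx1 hx2] at hd
  have hs := discPoly_sub_splits hq
    (amReal_add_period p q lam (Real.arccos x / (2 * Real.pi * q))) (t := 2 * x)
    (by rw [abs_le]; constructor <;> linarith)
  have hxt : 2 * lam ^ q * x + 2 * x = t := by
    rw [hx]
    field_simp
    ring
  rwa [hd, sub_sub, ← C_add, hxt] at hs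

theorem derivative_levelPoly_ne_zero (hq : 0 < q) (hpq : IsCoprime p (q : ℤ)) {lam : ℝ}
    (hlam : 0 < lam) {E : ℝ} (hE : |(levelPoly p q lam).eval E| < 2 + 2 * lam ^ q) :
    (derivative (levelPoly p q lam)).eval E ≠ 0 :=
  derivative_ne_zero_of_splits (levelPoly_monic hq p lam).1
    (by rwa [(levelPoly_monic hq p lam).2]) (fun _ ht => levelPoly_sub_splits hq hpq hlam ht) hE

/-- The set of energies at which the level polynomial takes the value `t`. -/
def levelRoots (p : ℤ) (q : ℕ) (lam t : ℝ) : Finset ℝ := (levelPoly p q lam - C t).roots.toFinset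

theorem levelPoly_sub_C_ne_zero (hq : 0 < q) (p : ℤ) (lam t : ℝ) : levelPoly p q lam - C t ≠ 0 := by
  intro h
  have h1 := natDegree_sub_C (p := levelPoly p q lam) (a := t)
  rw [h, natDegree_zero, (levelPoly_monic hq p lam).2] at h1
  omega

theorem mem_levelRoots (hq : 0 < q) {lam t E : ℝ} :
    E ∈ levelRoots p q lam t ↔ (levelPoly p q lam).eval E = t := by
  rw [levelRoots, Multiset.mem_toFinset, mem_roots (levelPoly_sub_C_ne_zero hq p lam t), IsRoot,
    eval_sub, eval_C, sub_eq_zero]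

theorem card_levelRoots (hq : 0 < q) (hpq : IsCoprime p (q : ℤ)) {lam : ℝ} (hlam : 0 < lam) {t : ℝ}
    (ht : |t| < 2 + 2 * lam ^ q) : (levelRoots p q lam t).card = q := by
  rw [levelRoots, card_roots_of_splits (levelPoly_sub_splits hq hpq hlam ht.le)
    (levelPoly_sub_C_ne_zero hq p lam t), natDegree_sub_C, (levelPoly_monic hq p lam).2]
  intro x hx
  rw [eval_sub, eval_C, sub_eq_zero] at hx
  rw [derivative_sub, derivative_C, sub_zero]
  exact derivative_levelPoly_ne_zero hq hpq hlam (by rwa [hx])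

/-! ### The two reflection-symmetric phases -/

/-- The almost Mathieu potential at unit coupling. -/
def cosProfile (α θ : ℝ) (n : ℤ) : ℝ := 2 * Real.cos (2 * Real.pi * (n * α + θ))

theorem amReal_eq_mul (α lam θ : ℝ) : amReal α lam θ = fun n => lam * cosProfile α θ n := by
  funext n
  rw [amReal, cosProfile]
  ring

/-- A phase `θ` with `2 θ = - c p / q + s` for an integer `s` makes the potential symmetric under
`n ↦ c - n`; the parities of `s` and `s + p` decide whether fixed sites are maxima or minima. -/
theorem reflectionProfile_cos (hq : 0 < q) (hpq : IsCoprime p (q : ℤ)) {θ ε : ℝ} {c s : ℤ}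
    (hθ : 2 * θ = -c * ((p : ℝ) / q) + s) (h_even : Even c → ε = -1) (h_odd : Odd c → ε = 1)
    (hmax : ∀ k, 2 * k = c → Even s) (hmin : ∀ k, 2 * k = c + q → Odd (s + p)) :
    ReflectionProfile (cosProfile ((p : ℝ) / q) θ) q c ε := by
  have hq' : (q : ℝ) ≠ 0 := by exact_mod_cast hq.ne'
  have hdvd : ∀ a k : ℤ, (a : ℝ) * ((p : ℝ) / q) = k → (q : ℤ) ∣ a := by
    intro a k h
    have h1 : (a : ℝ) * p = k * q := by field_simp at h; linarith
    have h2 : a * p = k * q := by exact_mod_cast h1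
    exact hpq.symm.dvd_of_dvd_mul_right ⟨k, by rw [h2, mul_comm]⟩
  refine ⟨?_, ?_, ?_, h_even, h_odd, ?_, ?_⟩
  · intro n
    have h := amReal_add_period p q 1 θ n
    simpa [amReal_eq_mul] using h
  · intro n
    rw [cosProfile, cosProfile, ← Real.cos_neg, ← Real.cos_sub_int_mul_two_pi _ (-s)]
    congr 2
    push_cast
    linear_combination (-2 * Real.pi) * hθ
  · intro m n h
    rw [cosProfile, cosProfile, mul_right_inj' two_ne_zero, Real.cos_eq_cos_iff] at h
    obtain ⟨k, hk | hk⟩ := h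
    · left
      refine hdvd _ (-k) ?_
      have h1 : 2 * Real.pi * ((n : ℝ) * ((p : ℝ) / q) + θ)
          = 2 * Real.pi * (k + (m * ((p : ℝ) / q) + θ)) := by rw [hk]; ring
      have h2 := mul_left_cancel₀ (by positivity) h1
      push_cast
      linear_combination -h2
    · right
      refine hdvd _ (k - s) ?_
      have h1 : 2 * Real.pi * ((n : ℝ) * ((p : ℝ) / q) + θ)
          = 2 * Real.pi * (k - (m * ((p : ℝ) / q) + θ)) := by rw [hk]; ring
      have h2 := mul_left_cancel₀ (by positivity) h1
      push_cast
      linear_combination h2 - hθ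
  · intro k hk n
    obtain ⟨j, hj⟩ := hmax k hk
    have h1 : 2 * Real.pi * ((k : ℝ) * ((p : ℝ) / q) + θ) = j * (2 * Real.pi) := by
      have h2 : (2 * k : ℝ) = c := by exact_mod_cast hk
      have h3 : (s : ℝ) = j + j := by exact_mod_cast hj
      rw [h3, ← h2] at hθ
      linear_combination Real.pi * hθ
    rw [cosProfile, cosProfile, h1, Real.cos_int_mul_two_pi]
    have := Real.cos_le_one (2 * Real.pi * ((n : ℝ) * ((p : ℝ) / q) + θ))
    linarith
  · intro k hk n
    obtain ⟨j, hj⟩ := hmin k hk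
    have h1 : 2 * Real.pi * ((k : ℝ) * ((p : ℝ) / q) + θ) = j * (2 * Real.pi) + Real.pi := by
      have h2 : (2 * k : ℝ) = c + q := by exact_mod_cast hk
      have h3 : (s : ℝ) + p = 2 * j + 1 := by exact_mod_cast hj
      have h4 : (q : ℝ) * ((p : ℝ) / q) = p := by field_simp
      linear_combination Real.pi * hθ + Real.pi * ((p : ℝ) / q) * h2 + Real.pi * h3 + Real.pi * h4
    rw [cosProfile, cosProfile, h1, add_comm (_ * _) Real.pi, Real.cos_add_int_mul_two_pi,
      Real.cos_pi]
    have := Real.neg_one_le_cos (2 * Real.pi * ((n : ℝ) * ((p : ℝ) / q) + θ))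
    linarith

theorem reflectionProfile_zero (hq : 0 < q) (hpq : IsCoprime p (q : ℤ)) :
    ReflectionProfile (cosProfile ((p : ℝ) / q) 0) q 0 (-1) := by
  refine reflectionProfile_cos hq hpq (s := 0) (by simp) (fun _ => rfl) (by simp) (by simp) ?_
  intro k hk
  rw [zero_add]
  by_contra hp
  rw [Int.not_odd_iff_even] at hp
  obtain ⟨j, hj⟩ := hp
  have h2 := hpq.isUnit_of_dvd' (x := 2) ⟨j, by omega⟩ ⟨k, by omega⟩
  exact absurd (Int.isUnit_iff.1 h2) (by norm_num)

theorem reflectionProfile_thetaPlus (hq : 0 < q) (hpq : IsCoprime p (q : ℤ)) :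
    ReflectionProfile (cosProfile ((p : ℝ) / q) (thetaPlus p q)) q (-1) 1 := by
  rw [thetaPlus]
  split_ifs with hp
  · refine reflectionProfile_cos hq hpq (s := 0) (by push_cast; ring) (by simp) (fun _ => rfl)
      (fun k hk => by omega) (fun k hk => by simpa using hp)
  · rw [Int.not_odd_iff_even] at hp
    refine reflectionProfile_cos hq hpq (s := 1) (by push_cast; ring) (by simp) (fun _ => rfl)
      (fun k hk => by omega) (fun k hk => by rw [add_comm]; exact hp.add_one)

theorem cos_thetaPlus (hq : 0 < q) (hpq : IsCoprime p (q : ℤ)) :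
    Real.cos (2 * Real.pi * (q * thetaPlus p q)) = -1 := by
  have hq' : (q : ℝ) ≠ 0 := by exact_mod_cast hq.ne'
  have h : ∀ a : ℤ, Odd a → Real.cos (a * Real.pi) = -1 := by
    intro a ha
    rw [Real.cos_int_mul_pi, ha.neg_one_zpow]
  rw [thetaPlus]
  split_ifs with hp
  · rw [← h p hp]
    congr 1
    field_simp
  · have hodd : Odd (p + q) := by
      rw [Int.not_odd_iff_even] at hp
      refine hp.add_odd ?_
      by_contra hqe
      rw [Int.not_odd_iff_even] at hqe
      obtain ⟨j, hj⟩ := hp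
      obtain ⟨k, hk⟩ := hqe
      have h2 := hpq.isUnit_of_dvd' (x := 2) ⟨j, by omega⟩ ⟨k, by omega⟩
      exact absurd (Int.isUnit_iff.1 h2) (by norm_num)
    rw [← h _ hodd]
    congr 1
    push_cast
    field_simp
    ring

end Level

/-! ### Integration over a band set -/

section Bands

theorem isCompact_band {P : ℝ[X]} (hdeg : 0 < P.natDegree) (K : ℝ) :
    IsCompact {x | |P.eval x| ≤ K} := by
  have hclosed : IsClosed {x | |P.eval x| ≤ K} := isClosed_le P.continuous.abs continuous_const
  have ht := P.tendsto_norm_atTop (natDegree_pos_iff_degree_pos.1 hdeg)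
    (tendsto_norm_cocompact_atTop (E := ℝ))
  obtain ⟨t, ht1, ht2⟩ := mem_cocompact.1 (ht (Ioi_mem_atTop K))
  refine ht1.of_isClosed_subset hclosed fun x hx => ?_
  by_contra hxt
  exact absurd (show K < |P.eval x| from ht2 hxt) (not_lt.2 hx)

variable {P : ℝ[X]} {K : ℝ} {Φ φ : ℝ → ℂ}

/-- A step at the endpoint `s` of a band which compensates the jump at `s` of the function equal to
`Φ` on the bands and to `0` elsewhere. The endpoint is a right endpoint if `P * P'` is positive
there. -/
def endpointStep (P : ℝ[X]) (Φ : ℝ → ℂ) (s x : ℝ) : ℂ :=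
  if 0 < P.eval s * (derivative P).eval s then (if s < x then Φ s else 0)
  else -(if s ≤ x then Φ s else 0)

theorem endpointStep_eventuallyEq {s x₀ : ℝ} (h : s ≠ x₀) :
    ∀ᶠ x in 𝓝 x₀, endpointStep P Φ s x = endpointStep P Φ s x₀ := by
  rcases h.lt_or_gt with h | h
  · filter_upwards [lt_mem_nhds h] with x hx
    simp only [endpointStep, hx, hx.le, h, h.le, if_true]
  · filter_upwards [gt_mem_nhds h] with x hx
    simp only [endpointStep, hx.not_gt, hx.not_ge, h.not_gt, h.not_ge, if_false]

/-- If `P` has no critical point in `{|P| ≤ K}`, this set is a finite union of bands, and the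
integral of a derivative over it is the signed sum over the endpoints. -/
theorem integral_band (hK : 0 < K) (hdeg : 0 < P.natDegree)
    (hcrit : ∀ x, |P.eval x| ≤ K → (derivative P).eval x ≠ 0)
    (hφ : ContinuousOn φ {x | |P.eval x| ≤ K})
    (hΦ : ∀ x ∈ {x | |P.eval x| ≤ K}, HasDerivWithinAt Φ (φ x) {x | |P.eval x| ≤ K} x)
    (S : Finset ℝ) (hS : ∀ x, x ∈ S ↔ |P.eval x| = K) :
    MeasureTheory.IntegrableOn φ {x | |P.eval x| ≤ K} ∧
      ∫ x in {x | |P.eval x| ≤ K}, φ x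
        = ∑ s ∈ S, (if 0 < P.eval s * (derivative P).eval s then 1 else -1) * Φ s := by
  classical
  set B : Set ℝ := {x | |P.eval x| ≤ K} with hB
  have hcomp : IsCompact B := isCompact_band hdeg K
  have hint : MeasureTheory.IntegrableOn φ B := hφ.integrableOn_compact hcomp
  refine ⟨hint, ?_⟩
  obtain ⟨R, hR0, hR⟩ : ∃ R : ℝ, 0 < R ∧ ∀ x ∈ B, |x| < R := by
    obtain ⟨R, hR⟩ := hcomp.isBounded.exists_norm_le
    exact ⟨|R| + 1, by positivity, fun x hx => by
      have := hR x hx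
      rw [Real.norm_eq_abs] at this
      linarith [le_abs_self R]⟩
  set h : ℝ → ℝ := fun x => P.eval x ^ 2 - K ^ 2 with hh
  have hmemB : ∀ x, x ∈ B ↔ h x ≤ 0 := fun x => by
    simp only [hB, hh, Set.mem_ofPred_eq, sub_nonpos, sq_le_sq, abs_of_pos hK]
  have hmemS : ∀ x, x ∈ S ↔ h x = 0 := fun x => by
    rw [hS, hh]
    simp only [sub_eq_zero, sq_eq_sq_iff_abs_eq_abs, abs_of_pos hK]
  have hhc : Continuous h := by fun_prop
  have hder : ∀ x, HasDerivAt h (2 * (P.eval x * (derivative P).eval x)) x := by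
    intro x
    refine (((P.hasDerivAt x).pow 2).sub_const (K ^ 2)).congr_deriv ?_
    norm_num [mul_assoc]
  -- The steps at the endpoints make up for the jumps of `Φ` cut off outside `B`, so that `g` is
  -- continuous and, away from the endpoints, a primitive of `φ` cut off outside `B`.
  set g : ℝ → ℂ := fun x => B.indicator Φ x + ∑ s ∈ S, endpointStep P Φ s x with hg
  have hrest : ∀ x₀, ∀ T ⊆ S, x₀ ∉ T → ∀ᶠ x in 𝓝 x₀,
      ∑ s ∈ T, endpointStep P Φ s x = ∑ s ∈ T, endpointStep P Φ s x₀ := by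
    intro x₀ T _ hx₀
    have := (Filter.eventually_all_finset T).2 fun s (hs : s ∈ T) =>
      endpointStep_eventuallyEq (P := P) (Φ := Φ) (s := s) (x₀ := x₀) (by rintro rfl; exact hx₀ hs)
    filter_upwards [this] with x hx
    exact Finset.sum_congr rfl hx
  have hderiv : ∀ x₀, x₀ ∉ S → HasDerivAt g (B.indicator φ x₀) x₀ := by
    intro x₀ hx₀
    have hne : h x₀ ≠ 0 := fun h0 => hx₀ ((hmemS x₀).2 h0)
    rcases hne.lt_or_gt with hlt | hgt
    · have hnhds : B ∈ 𝓝 x₀ := by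
        filter_upwards [hhc.continuousAt.eventually (gt_mem_nhds hlt)] with x hx
        exact (hmemB x).2 hx.le
      have h1 := (hΦ x₀ ((hmemB x₀).2 hlt.le)).hasDerivAt hnhds
      rw [Set.indicator_of_mem ((hmemB x₀).2 hlt.le)]
      refine (h1.add_const (∑ s ∈ S, endpointStep P Φ s x₀)).congr_of_eventuallyEq ?_
      filter_upwards [hrest x₀ S subset_rfl hx₀, hnhds] with x hx hxB
      simp only [hg]
      rw [hx, Set.indicator_of_mem hxB]
    · have hnot : ∀ᶠ x in 𝓝 x₀, x ∉ B := by
        filter_upwards [hhc.continuousAt.eventually (lt_mem_nhds hgt)] with x hx hxB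
        exact absurd ((hmemB x).1 hxB) hx.not_ge
      rw [Set.indicator_of_notMem hnot.self_of_nhds]
      refine (hasDerivAt_const x₀ (∑ s ∈ S, endpointStep P Φ s x₀)).congr_of_eventuallyEq ?_
      filter_upwards [hrest x₀ S subset_rfl hx₀, hnot] with x hx hxB
      simp only [hg]
      rw [hx, Set.indicator_of_notMem hxB, zero_add]
  have hcont : Continuous g := by
    rw [continuous_iff_continuousAt]
    intro x₀
    by_cases hx₀ : x₀ ∈ S
    · have hz : h x₀ = 0 := (hmemS x₀).1 hx₀
      have hxB : x₀ ∈ B := (hmemB x₀).2 hz.le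
      have hPx : P.eval x₀ ≠ 0 := fun h0 => by
        have := (hS x₀).1 hx₀
        rw [h0, abs_zero] at this
        exact hK.ne this
      have hw : P.eval x₀ * (derivative P).eval x₀ ≠ 0 := mul_ne_zero hPx (hcrit x₀ hxB)
      -- Up to a constant, `g` is near `x₀` equal to `Φ` inside the band and to `Φ x₀` outside.
      have hF : ContinuousAt (fun x => if x ∈ B then Φ x else Φ x₀) x₀ := by
        have h1 := (hΦ x₀ hxB).continuousWithinAt
        rw [Metric.continuousAt_iff']
        intro e he
        have h2 := Metric.continuousWithinAt_iff'.1 h1 e he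
        rw [eventually_nhdsWithin_iff] at h2
        filter_upwards [h2] with x hx
        by_cases hxB' : x ∈ B
        · simpa [hxB', hxB] using hx hxB'
        · simpa [hxB', hxB] using he
      have hS' : S = insert x₀ (S.erase x₀) := (Finset.insert_erase hx₀).symm
      have hr := hrest x₀ (S.erase x₀) (Finset.erase_subset _ _) (Finset.notMem_erase _ _)
      rcases hw.lt_or_gt with hneg | hpos
      · have hsign := eventually_nhdsWithin_sign_eq_of_deriv_neg (f := h) (x₀ := x₀)
          (by rw [(hder x₀).deriv]; linarith) hz
        refine ContinuousAt.congr (f := fun x => (if x ∈ B then Φ x else Φ x₀) - Φ x₀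
          + ∑ s ∈ S.erase x₀, endpointStep P Φ s x₀) ((hF.sub continuousAt_const).add
            continuousAt_const) ?_
        filter_upwards [hsign, hr] with x hx hrx
        simp only [hg]
        rw [hS', Finset.sum_insert (Finset.notMem_erase _ _), ← hS', hrx]
        rw [← add_assoc]
        congr 1
        have hiff : x ∈ B ↔ x₀ ≤ x := by
          rw [hmemB]
          rcases lt_trichotomy x x₀ with hc | hc | hc
          · rw [sign_pos (show 0 < x₀ - x by linarith), sign_eq_one_iff] at hx
            exact iff_of_false hx.not_ge hc.not_ge
          · simp [hc, hz]
          · rw [sign_neg (show x₀ - x < 0 by linarith), sign_eq_neg_one_iff] at hx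
            exact iff_of_true hx.le hc.le
        by_cases hc : x₀ ≤ x
        · rw [if_pos (hiff.2 hc), Set.indicator_of_mem (hiff.2 hc), endpointStep,
            if_neg hneg.not_gt, if_pos hc]
          ring
        · have hnot : x ∉ B := fun h0 => hc (hiff.1 h0)
          rw [if_neg hnot, Set.indicator_of_notMem hnot, endpointStep, if_neg hneg.not_gt,
            if_neg hc]
          ring
      · have hsign := eventually_nhdsWithin_sign_eq_of_deriv_pos (f := h) (x₀ := x₀)
          (by rw [(hder x₀).deriv]; linarith) hz
        refine ContinuousAt.congr (f := fun x => (if x ∈ B then Φ x else Φ x₀)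
          + ∑ s ∈ S.erase x₀, endpointStep P Φ s x₀) (hF.add continuousAt_const) ?_
        filter_upwards [hsign, hr] with x hx hrx
        simp only [hg]
        rw [hS', Finset.sum_insert (Finset.notMem_erase _ _), ← hS', hrx]
        rw [← add_assoc]
        congr 1
        have hiff : x ∈ B ↔ x ≤ x₀ := by
          rw [hmemB]
          rcases lt_trichotomy x x₀ with hc | hc | hc
          · rw [sign_neg (show x - x₀ < 0 by linarith), sign_eq_neg_one_iff] at hx
            exact iff_of_true hx.le hc.le
          · simp [hc, hz]
          · rw [sign_pos (show 0 < x - x₀ by linarith), sign_eq_one_iff] at hx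
            exact iff_of_false hx.not_ge hc.not_ge
        by_cases hc : x ≤ x₀
        · rw [if_pos (hiff.2 hc), Set.indicator_of_mem (hiff.2 hc), endpointStep, if_pos hpos,
            if_neg hc.not_gt, add_zero]
        · have hnot : x ∉ B := fun h0 => hc (hiff.1 h0)
          rw [if_neg hnot, Set.indicator_of_notMem hnot, endpointStep, if_pos hpos,
            if_pos (not_le.1 hc), zero_add]
    · exact (hderiv x₀ hx₀).continuousAt
  have hBm : MeasurableSet B := hcomp.isClosed.measurableSet
  have hftc := MeasureTheory.integral_eq_of_hasDerivAt_off_countable g (B.indicator φ)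
    (a := -R) (b := R) (s := (S : Set ℝ)) S.countable_toSet hcont.continuousOn
    (fun x hx => hderiv x hx.2)
    ((hint.integrable_indicator hBm).intervalIntegrable)
  have hsub : Set.Ioc (-R) R ∩ B = B :=
    Set.inter_eq_right.2 fun x hx => ⟨(abs_lt.1 (hR x hx)).1, (abs_lt.1 (hR x hx)).2.le⟩
  rw [intervalIntegral.integral_of_le (by linarith), MeasureTheory.setIntegral_indicator hBm,
    hsub] at hftc
  have hSR : ∀ s ∈ S, |s| < R := fun s hs => hR s (by
    rw [hB, Set.mem_ofPred_eq, (hS s).1 hs])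
  have hRB : ∀ x, |x| = R → x ∉ B := fun x hx hxB => (hR x hxB).ne hx
  have hgR : g R = ∑ s ∈ S, (if 0 < P.eval s * (derivative P).eval s then 1 else -1) * Φ s := by
    simp only [hg]
    rw [Set.indicator_of_notMem (hRB R (abs_of_pos hR0)), zero_add]
    refine Finset.sum_congr rfl fun s hs => ?_
    have h1 := (abs_lt.1 (hSR s hs)).2
    simp only [endpointStep, h1, h1.le, if_true]
    split_ifs <;> ring
  have hgR' : g (-R) = 0 := by
    simp only [hg]
    rw [Set.indicator_of_notMem (hRB (-R) (by rw [abs_neg, abs_of_pos hR0])), zero_add]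
    refine Finset.sum_eq_zero fun s hs => ?_
    have h1 := (abs_lt.1 (hSR s hs)).1
    simp only [endpointStep, h1.not_gt, h1.not_ge, if_false]
    split_ifs <;> simp
  rw [hftc, hgR, hgR', sub_zero]

end Bands

/-! ### Traces over the (anti)periodic sequences -/

section Traces

variable {p : ℤ} {q : ℕ}

theorem trace_eq_sum_of_eigenbasis {ι K V : Type*} [Fintype ι] [Field K] [AddCommGroup V]
    [Module K V] (b : Module.Basis ι K V) {A : Module.End K V} {μ : ι → K}
    (h : ∀ i, A (b i) = μ i • b i) : LinearMap.trace K V A = ∑ i, μ i := by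
  classical
  rw [LinearMap.trace_eq_matrix_trace K b, Matrix.trace]
  refine Finset.sum_congr rfl fun i _ => ?_
  rw [Matrix.diag_apply, LinearMap.toMatrix_apply, h, map_smul, Finsupp.smul_apply,
    Module.Basis.repr_self, Finsupp.single_eq_same, smul_eq_mul, mul_one]

theorem finrank_signedPeriodic_le (hq : 0 < q) (ε : ℤˣ) :
    Module.finrank ℂ (signedPeriodic q ε) ≤ q := by
  let f : signedPeriodic q ε →ₗ[ℂ] (Fin q → ℂ) :=
    { toFun := fun ψ i => (ψ : ℤ → ℂ) (i : ℕ)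
      map_add' := fun _ _ => rfl
      map_smul' := fun _ _ => rfl }
  have hf : Function.Injective f := by
    rw [← LinearMap.ker_eq_bot, LinearMap.ker_eq_bot']
    intro ψ hψ
    have hper : Function.Periodic (fun n => (ψ : ℤ → ℂ) n = 0) (q : ℤ) := fun n => by
      rcases Int.units_eq_one_or ε with h | h <;> simp [ψ.2 n, h]
    have hq' : (0 : ℤ) < q := by exact_mod_cast hq
    ext n
    have h0 := Int.emod_nonneg n hq'.ne'
    have h1 := Int.emod_lt_of_pos n hq'
    have h2 := congrFun hψ ⟨(n % q).toNat, by omega⟩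
    change (ψ : ℤ → ℂ) (((n % q).toNat : ℕ) : ℤ) = 0 at h2
    rw [Int.toNat_of_nonneg h0] at h2
    have h3 := hper.int_mul (n / q) (n % q)
    simp only [Int.cast_id, mul_comm (n / (q : ℤ)), Int.emod_add_mul_ediv] at h3
    exact h3.mpr h2
  simpa using LinearMap.finrank_le_finrank_of_injective hf

/-- At the phase of a reflection profile the eigenvalues of the (anti)periodic operator are the roots
of a level of the level polynomial, all simple, and the reflection acts on each eigenvector by the
sign of the derivative of the level polynomial. -/
theorem trace_applyFun_mul_signedReflection [NeZero q] (hpq : IsCoprime p (q : ℤ)) {lam : ℝ}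
    (hlam : 1 < lam) {θ t : ℝ} {c : ℤ} (ε : ℤˣ)
    (hb : ReflectionProfile (cosProfile ((p : ℝ) / q) θ) q c ((ε : ℤ) : ℝ))
    (ht : ∀ l : ℝ, 2 * l ^ q * Real.cos (2 * Real.pi * (q * θ)) + 2 * ((ε : ℤ) : ℝ)
      = t * (2 * l ^ q - 2)) (htt : |t| = 1) (Φ : ℝ → ℂ) :
    LinearMap.trace ℂ (signedPeriodic q ε)
        (applyFun Φ (amRestrict p q ε lam θ) * signedReflection q ε c)
      = ∑ E ∈ levelRoots p q lam (t * (2 * lam ^ q - 2)),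
        (if 0 < (derivative (levelPoly p q lam)).eval E then 1 else -1) * Φ E := by
  have hq : 0 < q := NeZero.pos q
  have hlam0 : 0 < lam := by linarith
  have hdisc : ∀ l E : ℝ, disc (fun n => E - l * cosProfile ((p : ℝ) / q) θ n) q 0
      = 2 * ((ε : ℤ) : ℝ) ↔ (levelPoly p q l).eval E = t * (2 * l ^ q - 2) := by
    intro l E
    have h := disc_amReal hq hpq l θ E
    rw [amReal_eq_mul] at h
    rw [h, ← ht l]
    exact sub_eq_iff_eq_add'
  have hlevel : ∀ l : ℝ, 0 < l → |t * (2 * l ^ q - 2)| < 2 + 2 * l ^ q := by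
    intro l hl
    rw [abs_mul, htt, one_mul, abs_lt]
    have := pow_pos hl q
    constructor <;> linarith
  have hderiv : ∀ l : ℝ, derivative (discPoly (fun n => l * cosProfile ((p : ℝ) / q) θ n) q)
      = derivative (levelPoly p q l) := by
    intro l
    rw [← amReal_eq_mul, discPoly_amReal hq hpq, derivative_sub, derivative_C, sub_zero]
  have hb2 : ∀ n, |cosProfile ((p : ℝ) / q) θ n| ≤ 2 := by
    intro n
    rw [cosProfile, abs_mul, abs_two]
    linarith [Real.abs_cos_le_one (2 * Real.pi * (n * ((p : ℝ) / q) + θ))]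
  set S := levelRoots p q lam (t * (2 * lam ^ q - 2)) with hS
  have hvec : ∀ E : S, ∃ (v : ℤ → ℝ) (π : ℝ),
      IsSol (fun n => E - lam * cosProfile ((p : ℝ) / q) θ n) v ∧
      (∀ n, v (n + q) = ((ε : ℤ) : ℝ) * v n) ∧ v ≠ 0 ∧ |π| = 1 ∧ ∀ n, v (c - n) = π * v n :=
    fun E => hb.exists_parity ((hdisc lam E).2 ((mem_levelRoots hq).1 E.2))
  choose v π hv hvp hv0 hπ1 hπ using hvec
  have hsgn : ∀ E : S,
      π E = if 0 < (derivative (levelPoly p q lam)).eval (E : ℝ) then 1 else -1 := by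
    intro E
    have h := hb.parity_mul_derivative_pos hq hb2 (fun l hl E hE => by
      rw [hderiv]
      exact derivative_levelPoly_ne_zero hq hpq hl (((hdisc l E).1 hE).symm ▸ hlevel l hl))
      hlam0 (hv E) (hvp E) (hv0 E) (hπ E)
    rw [hderiv] at h
    rcases eq_or_eq_neg_of_abs_eq (hπ1 E) with h1 | h1 <;> rw [h1] at h
    · rw [if_pos (by linarith), h1]
    · rw [if_neg (by linarith), h1]
  let w : S → signedPeriodic q ε := fun E => ⟨fun n => (v E n : ℂ), fun n => by
    change (v E (n + q) : ℂ) = _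
    rw [hvp E n]
    push_cast
    rfl⟩
  have hw : ∀ E, amRestrict p q ε lam θ (w E) = ((E : ℝ) : ℂ) • w E := by
    intro E
    ext n
    change (v E (n + 1) : ℂ) + (v E (n - 1) : ℂ) + amPotential ((p : ℝ) / q) lam θ n * (v E n : ℂ)
      = ((E : ℝ) : ℂ) * (v E n : ℂ)
    have h := hv E n
    rw [← Complex.ofReal_add, h, amPotential_eq_ofReal, amReal_eq_mul]
    push_cast
    ring
  have hwR : ∀ E, signedReflection q ε c (w E) = (π E : ℂ) • w E := by
    intro E
    ext n
    change (v E (c - n) : ℂ) = (π E : ℂ) * (v E n : ℂ)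
    rw [hπ E n, Complex.ofReal_mul]
  have hw0 : ∀ E, w E ≠ 0 := fun E h => hv0 E (by
    funext n
    exact Complex.ofReal_eq_zero.1 (congrFun (congrArg Subtype.val h) n))
  have hli : LinearIndependent ℂ w :=
    Module.End.eigenvectors_linearIndependent' (amRestrict p q ε lam θ)
      (fun E : S => ((E : ℝ) : ℂ)) (Complex.ofReal_injective.comp Subtype.val_injective) w
      fun E => ⟨Module.End.mem_eigenspace_iff.2 (hw E), hw0 E⟩
  -- There are as many eigenvalues as the dimension, so the eigenvectors form a basis.
  have hcard : Fintype.card S = q := by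
    rw [Fintype.card_coe, hS, card_levelRoots hq hpq hlam0 (hlevel lam hlam0)]
  let B := basisOfLinearIndependentOfCardEqFinrank' w hli
    (le_antisymm hli.fintype_card_le_finrank (hcard ▸ finrank_signedPeriodic_le hq ε))
  have hB : ∀ E, B E = w E := fun E => by simp [B]
  rw [trace_eq_sum_of_eigenbasis B (μ := fun E : S => (π E : ℂ) * Φ E), ← Finset.sum_coe_sort S]
  · refine Finset.sum_congr rfl fun E _ => ?_
    rw [hsgn E]
    split_ifs <;> simp
  · intro E
    rw [hB, Module.End.mul_apply, hwR, map_smul, applyFun_apply Φ _ E _ (hw E), smul_smul]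

end Traces

theorem proposition2p6 (p : ℤ) (q : ℕ) [NeZero q] (hpq : IsCoprime p (q : ℤ))
    (lam : ℝ) (hlam : 1 < lam) (Φ φ : ℝ → ℂ)
    (hφ : ContinuousOn φ (intersectionSpectrum ((p : ℝ) / q) lam))
    (hΦ : ∀ E ∈ intersectionSpectrum ((p : ℝ) / q) lam,
      HasDerivWithinAt Φ (φ E) (intersectionSpectrum ((p : ℝ) / q) lam) E) :
    MeasureTheory.Integrable φ (intersectionMeasure ((p : ℝ) / q) lam) ∧
    ∫ E, φ E ∂(intersectionMeasure ((p : ℝ) / q) lam) =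
      -(LinearMap.trace ℂ (periodicSpace q)
            (applyFun Φ (amPer p q lam (thetaPlus p q)) * reflPlus q)
          - LinearMap.trace ℂ (antiperiodicSpace q)
            (applyFun Φ (amAnti p q lam 0) * reflZero q)) := by
  have hq : 0 < q := NeZero.pos q
  have hlam0 : 0 < lam := by linarith
  have hpow : 1 < lam ^ q := one_lt_pow₀ hlam hq.ne'
  have hK : 0 < 2 * lam ^ q - 2 := by linarith
  have hper := trace_applyFun_mul_signedReflection hpq hlam (t := -1) 1
    (by simpa using reflectionProfile_thetaPlus hq hpq)
    (fun l => by rw [cos_thetaPlus hq hpq]; push_cast; ring) (by simp) Φ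
  have hanti := trace_applyFun_mul_signedReflection hpq hlam (t := 1) (-1)
    (by simpa using reflectionProfile_zero hq hpq)
    (fun l => by simp; ring) (by simp) Φ
  rw [intersectionMeasure]
  rw [intersectionSpectrum_eq hq hpq hlam] at hφ hΦ ⊢
  have hdisj : Disjoint (levelRoots p q lam (1 * (2 * lam ^ q - 2)))
      (levelRoots p q lam (-1 * (2 * lam ^ q - 2))) := by
    rw [Finset.disjoint_left]
    intro E h1 h2
    rw [mem_levelRoots hq] at h1 h2
    linarith
  obtain ⟨hint, heq⟩ := integral_band hK (by rwa [(levelPoly_monic hq p lam).2])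
    (fun x hx => derivative_levelPoly_ne_zero hq hpq hlam0 (hx.trans_lt (by linarith))) hφ hΦ
    ((levelRoots p q lam (1 * (2 * lam ^ q - 2))).disjUnion
      (levelRoots p q lam (-1 * (2 * lam ^ q - 2))) hdisj) (fun x => by
        rw [Finset.mem_disjUnion, mem_levelRoots hq, mem_levelRoots hq, abs_eq hK.le, one_mul,
          neg_one_mul])
  refine ⟨hint, ?_⟩
  -- On `P = K` the sign of `P * P'` is that of `P'`, and on `P = -K` it is the opposite.
  rw [heq, hper, hanti, Finset.sum_disjUnion, neg_sub,
    sub_eq_add_neg (Finset.sum _ _), ← Finset.sum_neg_distrib]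
  congr 1
  · refine Finset.sum_congr rfl fun E hE => ?_
    rw [(mem_levelRoots hq).1 hE, one_mul]
    simp only [mul_pos_iff_of_pos_left hK]
  · refine Finset.sum_congr rfl fun E hE => ?_
    have hne := derivative_levelPoly_ne_zero hq hpq hlam0 (E := E) (by
      rw [(mem_levelRoots hq).1 hE, abs_mul, abs_neg, abs_one, one_mul, abs_of_pos hK]
      linarith)
    rw [(mem_levelRoots hq).1 hE]
    rcases hne.lt_or_gt with h | h
    · rw [if_pos (by nlinarith), if_neg h.not_gt]
      ring
    · rw [if_neg (by nlinarith), if_pos h]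
      ring


end
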